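/- All $q$-series are formal power series in $q$, and $(a;q)_k=\prod_{j=0}^{k-1}(1-aq^j)$, $(a;q)_\infty=\prod_{j\ge 0}(1-aq^j)$, $(q)_k=(q;q)_k$, $(q)_\infty=(q;q)_\infty$, $(a_1,a_2,a_3;q)_\infty=(a_1;q)_\infty(a_2;q)_\infty(a_3;q)_\infty$. The horizontal Durfee rectangle (respectively the Durfee square) of a partition is the largest rectangle with $k$ columns and $k-1$ rows (respectively the largest $k\times k$ square) that fits in the top-left corner of its Young diagram; a rectangle with one column and no row is allowed. Successive rectangles and squares are obtained by repeating the construction on the rows below the previous one. For integers $r\ge 1$ and $1\le i\le r$, let $\mathcal D_{r,i}$ be the set of partitions for which no row is left below after drawing $r-i$ successive horizontal Durfee rectangles followed by $i-1$ successive Durfee squares, and let $\mathcal E_{r,i}$ be the set of partitions with no part congruent to $0$ or $\pm i$ modulo $2r+1$. Both are understood to contain the empty partition of $0$. Let $r>0$ be an integer. Then: 1. For every integer $0\le i\le r-1$, $$\sum_{s_1\ge\dots\ge s_{r-1}\ge 0}\frac{q^{s_1^2+\dots+s_{r-1}^2-s_1-\dots-s_i}\,(1-q^{s_i})}{(q)_{s_1-s_2}\cdots(q)_{s_{r-2}-s_{r-1}}(q)_{s_{r-1}}}=\frac{(q^{2r+1},q^{r-i},q^{r+i+1};q^{2r+1})_\infty}{(q)_\infty},$$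 where for $i=0$ the factor $(1-q^{s_i})$ is omitted, and for $r=1$ the left-hand side is $1$. 2. For every integer $0\le i\le r-1$, the left-hand side of this identity is the generating function $\sum_{n\ge 0}D_{r,r-i}(n)q^n$, where $D_{r,i}(n)$ denotes the number of partitions of $n$ in $\mathcal D_{r,i}$. 3. For every integer $1\le i\le r$ and every $n\ge 0$, the number $D_{r,i}(n)$ equals the number $E_{r,i}(n)$ of partitions of $n$ in $\mathcal E_{r,i}$. -/

import Mathlib

open PowerSeries
open scoped PowerSeries.WithPiTopology

/-!
All `q`-series are formal power series in `q = X` with integer coefficients. The ring `ℤ⟦X⟧` has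
the topology of coefficientwise convergence, and `ℤ` is discrete, so an infinite sum or product
converges exactly when every coefficient is eventually constant.
-/

namespace AndrewsGordon

/-! ### `q`-shifted factorials -/

/-- The finite `q`-shifted factorial `(a; b)_k = ∏_{0 ≤ j < k} (1 - a b ^ j)`. -/
noncomputable def qPoch (a b : ℤ⟦X⟧) (k : ℕ) : ℤ⟦X⟧ :=
  ∏ j ∈ Finset.range k, (1 - a * b ^ j)

/-- The infinite `q`-shifted factorial `(a; b)_∞ = ∏_{j ≥ 0} (1 - a b ^ j)`. -/
noncomputable def qPochInf (a b : ℤ⟦X⟧) : ℤ⟦X⟧ :=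
  ∏' j : ℕ, (1 - a * b ^ j)

/-- The infinite products `(q ^ m; q ^ b)_∞` with `b > 0` converge. -/
theorem multipliable_qPochInf (m : ℕ) {b : ℕ} (hb : 0 < b) :
    Multipliable fun j : ℕ => (1 - (X : ℤ⟦X⟧) ^ m * ((X : ℤ⟦X⟧) ^ b) ^ j) := by
  simp_rw [sub_eq_add_neg]
  apply PowerSeries.WithPiTopology.multipliable_one_add_of_tendsto_order_atTop_nhds_top
  refine ENat.tendsto_nhds_top_iff_natCast_lt.mpr fun n => Filter.eventually_atTop.mpr ⟨n + 1, ?_⟩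
  intro j hj
  rw [PowerSeries.order_neg, ← pow_mul, ← pow_add, PowerSeries.order_X_pow]
  have : j ≤ b * j := Nat.le_mul_of_pos_left j hb
  exact_mod_cast (by omega : n < m + b * j)

/-- The denominators `(q)_k` are invertible. -/
theorem isUnit_qPoch (k : ℕ) : IsUnit (qPoch X X k) := by
  rw [PowerSeries.isUnit_iff_constantCoeff]
  simp [qPoch]

/-- The denominator `(q)_∞` is invertible. -/
theorem isUnit_qPochInf : IsUnit (qPochInf X X) := by
  have h : Multipliable fun j : ℕ => (1 - (X : ℤ⟦X⟧) * (X : ℤ⟦X⟧) ^ j) := by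
    simpa using multipliable_qPochInf 1 one_pos
  rw [PowerSeries.isUnit_iff_constantCoeff, qPochInf,
    h.map_tprod _ (WithPiTopology.continuous_constantCoeff ℤ)]
  simp

/-! ### The multiple sum and the infinite product -/

/-- The value `s_{j+1}` of a tuple `s = (s_1, …, s_m)`, with `s_{j+1} = 0` for `j ≥ m`. -/
def entry {m : ℕ} (s : Fin m → ℕ) (j : ℕ) : ℕ :=
  if h : j < m then s ⟨j, h⟩ else 0

/-- The exponent `s_1 ^ 2 + ⋯ + s_m ^ 2 - s_1 - ⋯ - s_i`; see `exponent_sub_le` for the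
subtraction. -/
def exponent {m : ℕ} (i : ℕ) (s : Fin m → ℕ) : ℕ :=
  ∑ j ∈ Finset.range m, entry s j ^ 2 - ∑ j ∈ Finset.range i, entry s j

/-- The natural number subtraction in `exponent` is never truncated when `i ≤ m`. -/
theorem exponent_sub_le {m i : ℕ} (hi : i ≤ m) (s : Fin m → ℕ) :
    ∑ j ∈ Finset.range i, entry s j ≤ ∑ j ∈ Finset.range m, entry s j ^ 2 :=
  (Finset.sum_le_sum fun j _ => Nat.le_self_pow two_ne_zero (entry s j)).trans
    (Finset.sum_le_sum_of_subset (Finset.range_mono hi))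

/-- The summand
`q ^ (s_1 ^ 2 + ⋯ + s_m ^ 2 - s_1 - ⋯ - s_i) (1 - q ^ s_i) / ((q)_{s_1 - s_2} ⋯ (q)_{s_m})`,
where the factor `1 - q ^ s_i` is omitted if `i = 0`. -/
noncomputable def summand {m : ℕ} (i : ℕ) (s : Fin m → ℕ) : ℤ⟦X⟧ :=
  X ^ exponent i s * (if i = 0 then 1 else 1 - X ^ entry s (i - 1)) *
    Ring.inverse (∏ j ∈ Finset.range m, qPoch X X (entry s j - entry s (j + 1)))

/-- The product `(q ^ (2r+1), q ^ (r-i), q ^ (r+i+1); q ^ (2r+1))_∞ / (q)_∞`. -/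
noncomputable def productSide (r i : ℕ) : ℤ⟦X⟧ :=
  qPochInf (X ^ (2 * r + 1)) (X ^ (2 * r + 1)) * qPochInf (X ^ (r - i)) (X ^ (2 * r + 1)) *
    qPochInf (X ^ (r + i + 1)) (X ^ (2 * r + 1)) * Ring.inverse (qPochInf X X)

/-! ### Durfee dissections

A partition is given by the list of its parts in nonincreasing order; the entry with index `j` is
the length of row `j + 1` of the Young diagram. -/

/-- The side of the Durfee square: the largest `k` such that the `k × k` square fits in the top-left
corner of the Young diagram, i.e. such that the first `k` parts exist and are at least `k`. -/
def durfeeSquare (l : List ℕ) : ℕ :=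
  Nat.findGreatest (fun k => ∀ j < k, k ≤ l.getD j 0) l.length

/-- The width of the horizontal Durfee rectangle: the largest `k` such that the rectangle with
`k` columns and `k - 1` rows fits in the top-left corner of the Young diagram. The rectangle with
one column and no row always fits. -/
def durfeeRectangle (l : List ℕ) : ℕ :=
  Nat.findGreatest (fun k => ∀ j < k - 1, k ≤ l.getD j 0) (l.length + 1)

/-- The rows below the Durfee square. -/
def belowSquare (l : List ℕ) : List ℕ := l.drop (durfeeSquare l)

/-- The rows below the horizontal Durfee rectangle. -/
def belowRectangle (l : List ℕ) : List ℕ := l.drop (durfeeRectangle l - 1)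

/-- The partitions of `n` in `𝓓_{r,i}`: after drawing `r - i` successive horizontal Durfee
rectangles, followed by `i - 1` successive Durfee squares, no row is left. -/
def durfeePartitions (r i n : ℕ) : Finset n.Partition :=
  Finset.univ.filter fun p =>
    belowSquare^[i - 1] (belowRectangle^[r - i] (p.parts.sort (· ≥ ·))) = []

/-- The partitions of `n` in `𝓔_{r,i}`: no part is congruent to `0` or `± i` modulo `2r+1`. -/
def congruencePartitions (r i n : ℕ) : Finset n.Partition :=
  Nat.Partition.restricted n fun m =>
    ¬ (m : ℤ) ≡ 0 [ZMOD 2 * r + 1] ∧ ¬ (m : ℤ) ≡ i [ZMOD 2 * r + 1] ∧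
      ¬ (m : ℤ) ≡ -i [ZMOD 2 * r + 1]

end AndrewsGordon

/-! The multiple sum is computed twice by one recursion, the Bailey step `baileyStep`, which sends f
to ∑_s q^{s(s-e)} f(s)/(q)_{N-s}, with e = 0 for squares and e = 1 for rectangles.

Analytically, the kernel 1/((q)_{s-j}(q)_{s+j-e}) is an eigenvector of the step with eigenvalue
q^{j(j-e)} (`sum_baileyKernel`, a form of q-Vandermonde). The finite Jacobi triple product expands
the unit sequence in the e = 0 kernels with theta coefficients. Each square step raises both theta
exponents by 1. Multiplication by 1 - q^N changes the kernel from e = 0 to e = 1 with the same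
coefficients, because the difference is odd in j. Each rectangle step then raises one exponent by 2.
As N → ∞ the triple product sums the resulting theta series with exponents r - i and r + i + 1.

Combinatorially, removing a k × (k - e) rectangle leaves a partition in a box on its right, counted
by a Gaussian binomial, and a partition with parts at most k below. Divided by (q)_{N-e}, this is
again a Bailey step (`invPoch_mul_listGenFun_dissectionStep`). The factor 1 - q^N turns 1/(q)_N into
the normalization 1/(q)_{N-1} needed for rectangles, so the same sequence counts Durfee dissections.

Finally, unfolding the recursion gives the sum over tuples, and (q)_∞ cancels against the product
for restricted partitions, leaving the forbidden residue classes. -/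

namespace AndrewsGordon

/-! ### Reciprocals of `q`-shifted factorials -/

/-- The reciprocal `1 / (Q; Q)_n`, which is `0` for `n < 0`. -/
noncomputable def invPoch (Q : ℤ⟦X⟧) (n : ℤ) : ℤ⟦X⟧ :=
  if n < 0 then 0 else Ring.inverse (qPoch Q Q n.toNat)

theorem isUnit_qPoch_self {Q : ℤ⟦X⟧} (hQ : constantCoeff Q = 0) (k : ℕ) : IsUnit (qPoch Q Q k) := by
  rw [PowerSeries.isUnit_iff_constantCoeff]
  simp [qPoch, hQ]

theorem invPoch_of_neg (Q : ℤ⟦X⟧) {n : ℤ} (hn : n < 0) : invPoch Q n = 0 := by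
  simp [invPoch, hn]

theorem invPoch_natCast (Q : ℤ⟦X⟧) (n : ℕ) : invPoch Q n = Ring.inverse (qPoch Q Q n) := by
  simp [invPoch]

theorem qPoch_mul_invPoch {Q : ℤ⟦X⟧} (hQ : constantCoeff Q = 0) (n : ℕ) :
    qPoch Q Q n * invPoch Q n = 1 := by
  rw [invPoch_natCast, Ring.mul_inverse_cancel _ (isUnit_qPoch_self hQ n)]

theorem invPoch_zero (Q : ℤ⟦X⟧) : invPoch Q 0 = 1 := by
  simp [invPoch, qPoch]

theorem qPoch_succ (a Q : ℤ⟦X⟧) (n : ℕ) : qPoch a Q (n + 1) = qPoch a Q n * (1 - a * Q ^ n) := by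
  simp [qPoch, Finset.prod_range_succ]

theorem one_sub_pow_mul_invPoch {Q : ℤ⟦X⟧} (hQ : constantCoeff Q = 0) (n : ℕ) :
    (1 - Q ^ n) * invPoch Q n = invPoch Q (n - 1) := by
  rcases n with _ | n
  · simp [invPoch_of_neg]
  · have h1 := qPoch_mul_invPoch hQ (n + 1)
    have h2 := qPoch_mul_invPoch hQ n
    rw [qPoch_succ, ← pow_succ'] at h1
    have : ((n + 1 : ℕ) : ℤ) - 1 = n := by push_cast; ring
    rw [this]
    linear_combination invPoch Q n * h1 - (1 - Q ^ (n + 1)) * invPoch Q ((n + 1 : ℕ) : ℤ) * h2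

theorem one_sub_pow_toNat_mul_invPoch {Q : ℤ⟦X⟧} (hQ : constantCoeff Q = 0) {n : ℤ} (hn : 0 ≤ n) :
    (1 - Q ^ n.toNat) * invPoch Q n = invPoch Q (n - 1) := by
  lift n to ℕ using hn
  simpa using one_sub_pow_mul_invPoch hQ n

theorem one_sub_X_pow_ne_zero {n : ℕ} (hn : n ≠ 0) : (1 - X ^ n : ℤ⟦X⟧) ≠ 0 := by
  intro h
  have := congrArg constantCoeff h
  simp [hn] at this

/-! ### The `q`-Chu–Vandermonde sum -/

theorem sum_invPoch_vandermonde (M d : ℕ) :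
    ∑ t ∈ Finset.range (M + 1), (X : ℤ⟦X⟧) ^ (t * (t + d)) *
        (invPoch X (M - t) * invPoch X t * invPoch X (t + d)) =
      invPoch X M * invPoch X (M + d) := by
  induction M generalizing d with
  | zero => simp [invPoch_zero]
  | succ M ih =>
    have hX : constantCoeff (X : ℤ⟦X⟧) = 0 := by simp
    apply mul_left_cancel₀ (one_sub_X_pow_ne_zero (n := M + 1) (by omega))
    -- Split 1 - q^{M+1} = (1 - q^{M+1-t}) + q^{M+1-t}(1 - q^t). The first part gives the case (M,
    -- d); the second, after t ↦ t + 1, gives (M, d + 1).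
    have key : ∀ t ∈ Finset.range (M + 1 + 1), (1 - (X : ℤ⟦X⟧) ^ (M + 1)) *
        (X ^ (t * (t + d)) * (invPoch X ((M + 1 : ℕ) - t) * invPoch X t * invPoch X (t + d))) =
        X ^ (t * (t + d)) * (invPoch X (M - t) * invPoch X t * invPoch X (t + d)) +
        X ^ (M + 1 - t + t * (t + d)) *
          (invPoch X ((M + 1 : ℕ) - t) * invPoch X (t - 1) * invPoch X (t + d)) := by
      intro t ht
      have ht' : t ≤ M + 1 := by simpa [Nat.lt_succ_iff] using ht
      have h1 := one_sub_pow_mul_invPoch hX (M + 1 - t)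
      have h2 := one_sub_pow_mul_invPoch hX t
      have e1 : ((M + 1 - t : ℕ) : ℤ) = ((M + 1 : ℕ) : ℤ) - t := by omega
      have e2 : ((M + 1 : ℕ) : ℤ) - t - 1 = M - t := by push_cast; ring
      rw [e1, e2] at h1
      have e3 : (X : ℤ⟦X⟧) ^ (M + 1) = X ^ (M + 1 - t) * X ^ t := by
        rw [← pow_add]; congr 1; omega
      rw [← h1, ← h2, e3, pow_add _ (M + 1 - t)]
      ring
    rw [Finset.mul_sum, Finset.sum_congr rfl key, Finset.sum_add_distrib]
    have s1 : ∑ t ∈ Finset.range (M + 1 + 1), (X : ℤ⟦X⟧) ^ (t * (t + d)) *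
        (invPoch X (M - t) * invPoch X t * invPoch X (t + d)) =
        invPoch X M * invPoch X (M + d) := by
      rw [Finset.sum_range_succ, ih, invPoch_of_neg X (n := (M : ℤ) - (M + 1 : ℕ)) (by push_cast; linarith)]
      simp
    have s2 : ∑ t ∈ Finset.range (M + 1 + 1), (X : ℤ⟦X⟧) ^ (M + 1 - t + t * (t + d)) *
          (invPoch X ((M + 1 : ℕ) - t) * invPoch X (t - 1) * invPoch X (t + d)) =
        X ^ (M + 1 + d) * (invPoch X M * invPoch X (M + (d + 1 : ℕ))) := by
      rw [Finset.sum_range_succ', ← ih, Finset.mul_sum]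
      simp only [Nat.cast_zero, zero_sub, invPoch_of_neg X (n := (-1 : ℤ)) (by norm_num), mul_zero,
        zero_mul, add_zero]
      apply Finset.sum_congr rfl
      intro t ht
      have ht' : t ≤ M := by simpa [Nat.lt_succ_iff] using ht
      have e0 : M + 1 - (t + 1) + (t + 1) * (t + 1 + d) = M + 1 + d + t * (t + (d + 1)) := by
        obtain ⟨u, rfl⟩ := Nat.exists_eq_add_of_le ht'
        rw [show t + u + 1 - (t + 1) = u by omega]
        ring
      have e1 : ((M + 1 : ℕ) : ℤ) - (t + 1 : ℕ) = M - t := by omega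
      have e2 : ((t + 1 : ℕ) : ℤ) - 1 = t := by omega
      have e3 : ((t + 1 : ℕ) : ℤ) + d = t + (d + 1 : ℕ) := by omega
      rw [e0, e1, e2, e3, pow_add, mul_assoc]
    rw [s1, s2]
    have h1 := one_sub_pow_mul_invPoch hX (M + 1)
    have h2 := one_sub_pow_mul_invPoch hX (M + 1 + d)
    have e1 : ((M + 1 : ℕ) : ℤ) - 1 = M := by push_cast; ring
    have e2 : ((M + 1 + d : ℕ) : ℤ) - 1 = M + d := by push_cast; ring
    have e3 : ((M + 1 + d : ℕ) : ℤ) = (M + 1 : ℕ) + d := by push_cast; ring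
    have e4 : (M : ℤ) + (d + 1 : ℕ) = (M + 1 : ℕ) + d := by push_cast; ring
    rw [e1] at h1
    rw [e2, e3] at h2
    rw [e4, ← h2, ← mul_assoc (1 - _), h1]
    ring

/-- The kernel `1 / ((q)_{s-j} (q)_{s+j-e})`. -/
noncomputable def baileyKernel (e s : ℕ) (j : ℤ) : ℤ⟦X⟧ :=
  invPoch X (s - j) * invPoch X (s + j - e)

theorem baileyKernel_sub (e s : ℕ) (j : ℤ) : baileyKernel e s (e - j) = baileyKernel e s j := by
  rw [baileyKernel, baileyKernel, mul_comm]
  congr 2 <;> ring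

theorem baileyKernel_of_lt {e s : ℕ} {j : ℤ} (h : (s : ℤ) < j) : baileyKernel e s j = 0 := by
  rw [baileyKernel, invPoch_of_neg X (by linarith), zero_mul]

/-- The Bailey lemma for a single kernel. The symmetry j ↦ e - j allows j ≥ e; the terms with s < j
vanish, and s = j + t turns the rest into q-Vandermonde with shift 2j - e. -/
theorem sum_baileyKernel {e : ℕ} (he : e ≤ 1) (N : ℕ) (j : ℤ) :
    ∑ s ∈ Finset.range (N + 1), (X : ℤ⟦X⟧) ^ (s * (s - e)) * invPoch X (N - s) *
      baileyKernel e s j = X ^ (j * (j - e)).toNat * baileyKernel e N j := by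
  wlog hj : (e : ℤ) ≤ j generalizing j
  · have := this (e - j) (by omega)
    simp_rw [baileyKernel_sub] at this
    rw [this]
    congr 3
    ring
  obtain ⟨k, rfl⟩ := Int.eq_ofNat_of_zero_le (le_trans (by positivity) hj)
  have hk : e ≤ k := by exact_mod_cast hj
  rcases lt_or_ge N k with hNk | hNk
  · rw [baileyKernel_of_lt (by exact_mod_cast hNk), mul_zero]
    apply Finset.sum_eq_zero
    intro s hs
    have : s ≤ N := by simpa [Nat.lt_succ_iff] using hs
    rw [baileyKernel_of_lt (by exact_mod_cast lt_of_le_of_lt this hNk), mul_zero]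
  · obtain ⟨M, rfl⟩ := Nat.exists_eq_add_of_le hNk
    obtain ⟨d, rfl⟩ := Nat.exists_eq_add_of_le hk
    rw [add_assoc (e + d), Finset.sum_range_add, Finset.sum_eq_zero, zero_add]
    · have e0 : (((e + d : ℕ) : ℤ) * (((e + d : ℕ) : ℤ) - e)).toNat = (e + d) * d := by
        have : (((e + d : ℕ) : ℤ) * (((e + d : ℕ) : ℤ) - e)) = (((e + d) * d : ℕ) : ℤ) := by
          push_cast; ring
        rw [this, Int.toNat_natCast]
      rw [e0, baileyKernel]
      have e1 : ((e + d + M : ℕ) : ℤ) - (e + d : ℕ) = M := by push_cast; ring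
      have e2 : ((e + d + M : ℕ) : ℤ) + (e + d : ℕ) - e = M + (e + 2 * d : ℕ) := by push_cast; ring
      rw [e1, e2, ← sum_invPoch_vandermonde, Finset.mul_sum]
      apply Finset.sum_congr rfl
      intro t _
      have e3 : (e + d + t) * (e + d + t - e) = (e + d) * d + t * (t + (e + 2 * d)) := by
        rw [show e + d + t - e = d + t by omega]; ring
      have e4 : ((e + d + M : ℕ) : ℤ) - (e + d + t : ℕ) = M - t := by push_cast; ring
      have e5 : ((e + d + t : ℕ) : ℤ) - (e + d : ℕ) = t := by push_cast; ring
      have e6 : ((e + d + t : ℕ) : ℤ) + (e + d : ℕ) - e = t + (e + 2 * d : ℕ) := by push_cast; ring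
      rw [baileyKernel, e3, e4, e5, e6, pow_add]
      ring
    · intro s hs
      rw [baileyKernel_of_lt (by exact_mod_cast Finset.mem_range.mp hs), mul_zero]

/-! ### The finite Jacobi triple product -/

/-- The triangular number `j (j + 1) / 2` of an integer. -/
def tri (j : ℤ) : ℕ := (j * (j + 1) / 2).toNat

theorem two_mul_tri (j : ℤ) : 2 * (tri j : ℤ) = j * (j + 1) := by
  have h0 : 0 ≤ j * (j + 1) := by
    rcases lt_or_ge j 0 with h | h
    · exact mul_nonneg_of_nonpos_of_nonpos h.le (by omega)
    · positivity
  rw [tri, Int.toNat_of_nonneg (Int.ediv_nonneg h0 (by norm_num)),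
    Int.mul_ediv_cancel' (Int.even_mul_succ_self j).two_dvd]

/-- The term `(-1)^j A^{j(j+1)/2} B^{j(j-1)/2}` of the theta series. -/
noncomputable def theta (A B : ℤ⟦X⟧) (j : ℤ) : ℤ⟦X⟧ :=
  (-1) ^ j.natAbs * A ^ tri j * B ^ tri (-j)

theorem theta_neg (A B : ℤ⟦X⟧) (j : ℤ) : theta A B (-j) = theta B A j := by
  simp [theta, mul_right_comm]

theorem neg_one_pow_natAbs_add_one (j : ℤ) :
    (-1 : ℤ⟦X⟧) ^ (j + 1).natAbs = -(-1) ^ j.natAbs := by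
  rcases lt_or_ge j 0 with h | h
  · rw [show j.natAbs = (j + 1).natAbs + 1 by omega, pow_succ]; ring
  · rw [show (j + 1).natAbs = j.natAbs + 1 by omega, pow_succ]; ring

/-- The ratio of consecutive theta terms is -A(AB)^j, written here without division or negative
exponents. -/
theorem theta_add_one_mul (A B : ℤ⟦X⟧) {j : ℤ} {M : ℕ} (hj : j ≤ M) :
    theta A B (j + 1) * (A * B) ^ (M - j).toNat = -(theta A B j * (A * (A * B) ^ M)) := by
  have h1 := two_mul_tri j
  have h2 := two_mul_tri (-j)
  have h3 := two_mul_tri (j + 1)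
  have h4 := two_mul_tri (-(j + 1))
  have e1 : tri (j + 1) + (M - j).toNat = tri j + (M + 1) := by
    zify; rw [Int.toNat_of_nonneg (by linarith)]; linarith
  have e2 : tri (-(j + 1)) + (M - j).toNat = tri (-j) + M := by
    zify; rw [Int.toNat_of_nonneg (by linarith)]; linarith
  rw [theta, theta, neg_one_pow_natAbs_add_one, mul_pow, mul_pow]
  calc _ = -((-1) ^ j.natAbs * A ^ (tri (j + 1) + (M - j).toNat) *
        B ^ (tri (-(j + 1)) + (M - j).toNat)) := by ring
    _ = _ := by rw [e1, e2]; ring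

theorem sum_Icc_shift {R : Type*} [AddCommGroup R] (f : ℤ → R) (L : ℕ) (h0 : f (-L) = 0)
    (h1 : f (L + 1) = 0) :
    ∑ j ∈ Finset.Icc (-L : ℤ) L, f (j + 1) = ∑ j ∈ Finset.Icc (-L : ℤ) L, f j := by
  have e1 : ∑ j ∈ Finset.Icc (-L : ℤ) L, f (j + 1) = ∑ j ∈ Finset.Icc (-L + 1 : ℤ) (L + 1), f j :=
    Finset.sum_nbij' (fun j => j + 1) (fun j => j - 1) (by simp) (by simp)
      (by simp) (by simp) (by simp)
  have e2 : ∑ j ∈ Finset.Icc (-L + 1 : ℤ) (L + 1), f j = ∑ j ∈ Finset.Icc (-L : ℤ) (L + 1), f j := by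
    apply Finset.sum_subset
    · intro j; simp; omega
    · intro j hj hj'
      obtain rfl : j = -L := by simp at hj hj'; omega
      exact h0
  have e3 : ∑ j ∈ Finset.Icc (-L : ℤ) L, f j = ∑ j ∈ Finset.Icc (-L : ℤ) (L + 1), f j := by
    apply Finset.sum_subset
    · intro j; simp; omega
    · intro j hj hj'
      obtain rfl : j = L + 1 := by simp at hj hj'; omega
      exact h1
  rw [e1, e2, e3]

theorem sum_Icc_neg {R : Type*} [AddCommGroup R] (f : ℤ → R) (L : ℕ) :
    ∑ j ∈ Finset.Icc (-L : ℤ) L, f (-j) = ∑ j ∈ Finset.Icc (-L : ℤ) L, f j :=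
  Finset.sum_nbij' (fun j => -j) (fun j => -j) (by simp; intros; omega) (by simp; intros; omega)
      (by simp) (by simp) (by simp)

/-- Split 1 - Q^{M+K+1} = (1 - Q^{M+1-j}) + Q^{M+1-j}(1 - Q^{K+j}). The second part, shifted by j ↦
j + 1, is -AQ^M times the first. The window [-L, L] contains the support, so the shift loses
nothing. -/
theorem sum_theta_succ {A B : ℤ⟦X⟧} (hQ : constantCoeff (A * B) = 0) {M K L : ℕ} (hM : M < L)
    (hK : K ≤ L) :
    (1 - (A * B) ^ (M + K + 1)) * ∑ j ∈ Finset.Icc (-L : ℤ) L,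
        theta A B j * (invPoch (A * B) ((M + 1 : ℕ) - j) * invPoch (A * B) (K + j)) =
      (1 - A * (A * B) ^ M) * ∑ j ∈ Finset.Icc (-L : ℤ) L,
        theta A B j * (invPoch (A * B) (M - j) * invPoch (A * B) (K + j)) := by
  set Q := A * B with hQdef
  have key : ∀ j ∈ Finset.Icc (-L : ℤ) L, (1 - Q ^ (M + K + 1)) *
      (theta A B j * (invPoch Q ((M + 1 : ℕ) - j) * invPoch Q (K + j))) =
      theta A B j * (invPoch Q (M - j) * invPoch Q (K + j)) +
      theta A B j * Q ^ ((M + 1 : ℕ) - j).toNat *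
        (invPoch Q ((M + 1 : ℕ) - j) * invPoch Q (K + j - 1)) := by
    intro j _
    rcases lt_or_ge ((M + 1 : ℕ) : ℤ) j with h | h
    · rw [invPoch_of_neg Q (n := (M + 1 : ℕ) - j) (by linarith),
        invPoch_of_neg Q (n := M - j) (by push_cast at h; linarith)]
      simp
    rcases lt_or_ge ((K : ℤ) + j) 0 with h' | h'
    · rw [invPoch_of_neg Q h', invPoch_of_neg Q (n := K + j - 1) (by linarith)]
      simp
    · have h1 := one_sub_pow_toNat_mul_invPoch hQ (n := (M + 1 : ℕ) - j) (by linarith)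
      have h2 := one_sub_pow_toNat_mul_invPoch hQ h'
      have e1 : ((M + 1 : ℕ) : ℤ) - j - 1 = M - j := by push_cast; ring
      have e2 : Q ^ (M + K + 1) = Q ^ (((M + 1 : ℕ) : ℤ) - j).toNat * Q ^ ((K : ℤ) + j).toNat := by
        rw [← pow_add]; congr 1; omega
      rw [e1] at h1
      rw [← h1, ← h2, e2]
      ring
  rw [Finset.mul_sum, Finset.sum_congr rfl key, Finset.sum_add_distrib, ← sum_Icc_shift (fun j =>
    theta A B j * Q ^ ((M + 1 : ℕ) - j).toNat *
        (invPoch Q ((M + 1 : ℕ) - j) * invPoch Q (K + j - 1)))]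
  · rw [sub_mul, one_mul, sub_eq_add_neg, Finset.mul_sum, ← Finset.sum_neg_distrib]
    congr 1
    apply Finset.sum_congr rfl
    intro j _
    have e1 : ((M + 1 : ℕ) : ℤ) - (j + 1) = M - j := by push_cast; ring
    have e2 : (K : ℤ) + (j + 1) - 1 = K + j := by ring
    rw [e1, e2]
    rcases lt_or_ge (M : ℤ) j with h | h
    · rw [invPoch_of_neg Q (n := M - j) (by linarith)]
      simp
    · rw [theta_add_one_mul A B h]
      ring
  · rw [invPoch_of_neg Q (n := K + -L - 1) (by omega)]; simp
  · rw [invPoch_of_neg Q (n := (M + 1 : ℕ) - (L + 1)) (by omega)]; simp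

/-- The finite form of the Jacobi triple product identity. -/
theorem finite_jacobi_triple {A B : ℤ⟦X⟧} (hQ : constantCoeff (A * B) = 0) {M K L : ℕ} (hM : M ≤ L)
    (hK : K ≤ L) :
    qPoch (A * B) (A * B) (M + K) * ∑ j ∈ Finset.Icc (-L : ℤ) L,
        theta A B j * (invPoch (A * B) (M - j) * invPoch (A * B) (K + j)) =
      qPoch A (A * B) M * qPoch B (A * B) K := by
  induction M with
  | succ M ih =>
    have h := sum_theta_succ hQ (Nat.lt_of_succ_le hM) hK
    rw [qPoch_succ A, show M + 1 + K = M + K + 1 by ring, qPoch_succ, ← pow_succ', mul_assoc, h,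
      ← mul_assoc, mul_comm (qPoch _ _ _), mul_assoc, ih (by omega)]
    ring
  | zero =>
    induction K with
    | succ K ih =>
      have hQ' : constantCoeff (B * A) = 0 := by rwa [mul_comm]
      have h := sum_theta_succ hQ' (Nat.lt_of_succ_le hK) (Nat.zero_le L)
      -- Reflecting j ↦ -j exchanges A with B and M with K, so the recursion in K is the one already
      -- proved in M.
      rw [← sum_Icc_neg, ← sum_Icc_neg (fun j => theta B A j *
        (invPoch (B * A) (K - j) * invPoch (B * A) ((0 : ℕ) + j)))] at h
      simp_rw [theta_neg, mul_comm B A, sub_neg_eq_add, ← sub_eq_add_neg,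
        mul_comm (invPoch (A * B) ((K + 1 : ℕ) + _)), mul_comm (invPoch (A * B) (K + _))] at h
      have ih := ih (by omega)
      simp only [zero_add, add_zero] at h ih ⊢
      rw [qPoch_succ B, qPoch_succ (A * B), ← pow_succ', mul_assoc, h, ← mul_assoc,
        mul_comm (qPoch _ _ _), mul_assoc, ih]
      ring
    | zero =>
      rw [Finset.sum_eq_single 0]
      · simp [qPoch, theta, tri, invPoch_zero]
      · intro j _ hj
        rcases lt_or_gt_of_ne hj with h | h
        · rw [invPoch_of_neg _ (n := (0 : ℕ) + j) (by simpa using h)]; simp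
        · rw [invPoch_of_neg _ (n := (0 : ℕ) - j) (by simpa using h)]; simp
      · simp

theorem sum_theta_one_mul_baileyKernel {N L : ℕ} (h : N ≤ L) :
    ∑ j ∈ Finset.Icc (-L : ℤ) L, theta 1 X j * baileyKernel 0 N j = if N = 0 then 1 else 0 := by
  have hX : constantCoeff (1 * X : ℤ⟦X⟧) = 0 := by simp
  have key := finite_jacobi_triple hX h h
  simp only [one_mul] at key hX
  have e : ∀ j : ℤ, baileyKernel 0 N j = invPoch X (N - j) * invPoch X (N + j) := by
    simp [baileyKernel]
  simp_rw [e]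
  split_ifs with h0
  · subst h0
    simpa [qPoch] using key
  · obtain ⟨n, rfl⟩ := Nat.exists_eq_succ_of_ne_zero h0
    -- The factor of index 0 in (1; q)_{n+1} is 1 - 1.
    have : qPoch (1 : ℤ⟦X⟧) X (n + 1) = 0 := by simp [qPoch, Finset.prod_range_succ']
    rw [this, zero_mul] at key
    exact ((isUnit_qPoch_self hX _).mul_right_eq_zero).mp key

/-! ### Iterating the Bailey lemma -/

/-- One step `f ↦ (N ↦ ∑_s q^{s(s-e)} f(s) / (q)_{N-s})` of a Bailey chain. -/
noncomputable def baileyStep (e : ℕ) (f : ℕ → ℤ⟦X⟧) (N : ℕ) : ℤ⟦X⟧ :=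
  ∑ s ∈ Finset.range (N + 1), X ^ (s * (s - e)) * invPoch X (N - s) * f s

/-- The multiple sum with exponents `s ^ 2` obtained from `m` steps applied to the unit sequence. -/
noncomputable def squareSum (m : ℕ) : ℕ → ℤ⟦X⟧ :=
  (baileyStep 0)^[m] fun N => if N = 0 then 1 else 0

/-- The multiple sum with `i` outer summations with exponents `s ^ 2 - s`. -/
noncomputable def rectSum (m i : ℕ) : ℕ → ℤ⟦X⟧ :=
  (baileyStep 1)^[i] fun N => (1 - X ^ N) * squareSum m N

theorem baileyStep_eq {e L : ℕ} (he : e ≤ 1) {f : ℕ → ℤ⟦X⟧} {c : ℤ → ℤ⟦X⟧}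
    (hf : ∀ s ≤ L, f s = ∑ j ∈ Finset.Icc (-L : ℤ) L, c j * baileyKernel e s j) {N : ℕ}
    (hN : N ≤ L) : baileyStep e f N =
      ∑ j ∈ Finset.Icc (-L : ℤ) L, c j * X ^ (j * (j - e)).toNat * baileyKernel e N j := by
  have h : ∀ s ∈ Finset.range (N + 1), X ^ (s * (s - e)) * invPoch X (N - s) * f s =
      ∑ j ∈ Finset.Icc (-L : ℤ) L,
        c j * (X ^ (s * (s - e)) * invPoch X (N - s) * baileyKernel e s j) := by
    intro s hs
    rw [hf s (by simp at hs; omega), Finset.mul_sum]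
    exact Finset.sum_congr rfl fun j _ => by ring
  rw [baileyStep, Finset.sum_congr rfl h, Finset.sum_comm]
  refine Finset.sum_congr rfl fun j _ => ?_
  rw [← Finset.mul_sum, sum_baileyKernel he, mul_assoc]

theorem theta_X_pow (a b : ℕ) (j : ℤ) :
    theta (X ^ a) (X ^ b) j = (-1) ^ j.natAbs * X ^ (a * tri j + b * tri (-j)) := by
  rw [theta, ← pow_mul, ← pow_mul, mul_assoc, ← pow_add]

theorem theta_mul_X_pow_sq (a b : ℕ) (j : ℤ) :
    theta (X ^ a) (X ^ b) j * X ^ (j * (j - (0 : ℕ))).toNat =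
      theta (X ^ (a + 1)) (X ^ (b + 1)) j := by
  have h : (j * (j - (0 : ℕ))).toNat = tri j + tri (-j) := by
    have h1 := two_mul_tri j
    have h2 := two_mul_tri (-j)
    have : j * (j - (0 : ℕ)) = ((tri j + tri (-j) : ℕ) : ℤ) := by push_cast; linarith
    rw [this, Int.toNat_natCast]
  rw [h, theta_X_pow, theta_X_pow, mul_assoc, ← pow_add]
  congr 2
  ring

theorem theta_mul_X_pow_sq_sub (a b : ℕ) (j : ℤ) :
    theta (X ^ a) (X ^ b) j * X ^ (j * (j - (1 : ℕ))).toNat =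
      theta (X ^ a) (X ^ (b + 2)) j := by
  have h : (j * (j - (1 : ℕ))).toNat = 2 * tri (-j) := by
    have h2 := two_mul_tri (-j)
    have : j * (j - (1 : ℕ)) = ((2 * tri (-j) : ℕ) : ℤ) := by push_cast; linarith
    rw [this, Int.toNat_natCast]
  rw [h, theta_X_pow, theta_X_pow, mul_assoc, ← pow_add]
  congr 2
  ring

theorem squareSum_eq {m N L : ℕ} (h : N ≤ L) : squareSum m N =
    ∑ j ∈ Finset.Icc (-L : ℤ) L, theta (X ^ m) (X ^ (m + 1)) j * baileyKernel 0 N j := by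
  induction m generalizing N with
  | zero =>
    simp only [pow_zero, zero_add, pow_one]
    rw [sum_theta_one_mul_baileyKernel h]
    rfl
  | succ m ih =>
    rw [squareSum, Function.iterate_succ_apply']
    change baileyStep 0 (squareSum m) N = _
    rw [baileyStep_eq (by norm_num) (fun s hs => ih hs) h]
    simp_rw [theta_mul_X_pow_sq]

theorem baileyKernel_one (N : ℕ) (j : ℤ) :
    baileyKernel 1 N j = (1 - X ^ (N + j).toNat) * baileyKernel 0 N j := by
  simp only [baileyKernel, Nat.cast_one, Nat.cast_zero, sub_zero]
  rcases lt_or_ge ((N : ℤ) + j) 0 with h | h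
  · rw [invPoch_of_neg X h, invPoch_of_neg X (n := N + j - 1) (by linarith)]
    simp
  · rw [← one_sub_pow_toNat_mul_invPoch (by simp) h]
    ring

/-- The e = 1 kernel is 1 - q^{N+j} times the e = 0 kernel. Replacing 1 - q^N by 1 - q^{N+j} changes
the summand by `T j`, which is odd in j and so sums to 0. -/
theorem one_sub_X_pow_mul_squareSum {m N L : ℕ} (h : N ≤ L) : (1 - X ^ N) * squareSum m N =
    ∑ j ∈ Finset.Icc (-L : ℤ) L, theta (X ^ m) (X ^ (m + 1)) j * baileyKernel 1 N j := by
  set T : ℤ → ℤ⟦X⟧ := fun j =>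
    theta (X ^ m) (X ^ (m + 1)) j * (X ^ N - X ^ (N + j).toNat) * baileyKernel 0 N j with hT
  have hanti : ∀ j, T (-j) = - T j := by
    intro j
    have hW : baileyKernel 0 N (-j) = baileyKernel 0 N j := by
      simpa using baileyKernel_sub 0 N j
    -- For |j| > N one of the exponents N ± j would be truncated, but the kernel vanishes there.
    rcases lt_or_ge (N : ℤ) j with h1 | h1
    · simp only [hT, hW, baileyKernel_of_lt h1, mul_zero, neg_zero]
    rcases lt_or_ge (N : ℤ) (-j) with h2 | h2
    · simp only [hT]
      rw [hW, ← hW, baileyKernel_of_lt h2]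
      simp
    · have t1 := two_mul_tri j
      have t2 := two_mul_tri (-j)
      have t3 : (tri j : ℤ) = tri (-j) + j := by linarith
      have e1 : m * tri (-j) + (m + 1) * tri j + N =
          m * tri j + (m + 1) * tri (-j) + (N + j).toNat := by
        zify; rw [Int.toNat_of_nonneg (by linarith), t3]; ring
      have e2 : m * tri (-j) + (m + 1) * tri j + (N + -j).toNat =
          m * tri j + (m + 1) * tri (-j) + N := by
        zify; rw [Int.toNat_of_nonneg (by linarith), t3]; ring
      simp only [hT]
      rw [hW, theta_X_pow, theta_X_pow, Int.natAbs_neg, neg_neg]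
      calc _ = (-1) ^ j.natAbs * (X ^ (m * tri (-j) + (m + 1) * tri j + N) -
            X ^ (m * tri (-j) + (m + 1) * tri j + (N + -j).toNat)) * baileyKernel 0 N j := by ring
        _ = _ := by rw [e1, e2]; ring
  have hzero : ∑ j ∈ Finset.Icc (-L : ℤ) L, T j = 0 := by
    have := sum_Icc_neg T L
    simp_rw [hanti, Finset.sum_neg_distrib] at this
    ext n
    have h := congrArg (coeff n) this
    rw [map_neg] at h
    rw [map_zero]
    linarith
  rw [squareSum_eq h, Finset.mul_sum, ← sub_eq_zero, ← Finset.sum_sub_distrib, ← neg_eq_zero,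
    ← hzero, ← Finset.sum_neg_distrib]
  refine Finset.sum_congr rfl fun j _ => ?_
  rw [baileyKernel_one]
  ring

theorem rectSum_eq {m i N L : ℕ} (h : N ≤ L) : rectSum m i N =
    ∑ j ∈ Finset.Icc (-L : ℤ) L, theta (X ^ m) (X ^ (m + 2 * i + 1)) j * baileyKernel 1 N j := by
  induction i generalizing N with
  | zero => exact one_sub_X_pow_mul_squareSum h
  | succ i ih =>
    rw [rectSum, Function.iterate_succ_apply']
    change baileyStep 1 (rectSum m i) N = _
    rw [baileyStep_eq le_rfl (fun s hs => ih hs) h]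
    simp_rw [theta_mul_X_pow_sq_sub]
    rfl

/-! ### The limit of the finite identities -/

/-- Every factor of index at least l is 1 modulo q^{m+bl}. -/
theorem X_pow_dvd_qPochInf_sub {m b l p : ℕ} (hb : 0 < b) (hp : p ≤ m + b * l) :
    (X : ℤ⟦X⟧) ^ p ∣ qPochInf (X ^ m) (X ^ b) - qPoch (X ^ m) (X ^ b) l := by
  have hstep : ∀ t, (X : ℤ⟦X⟧) ^ p ∣ qPoch (X ^ m) (X ^ b) (l + t) - qPoch (X ^ m) (X ^ b) l := by
    intro t
    induction t with
    | zero => simp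
    | succ t ih =>
      rw [← add_assoc, qPoch_succ]
      have : (X : ℤ⟦X⟧) ^ p ∣ X ^ m * (X ^ b) ^ (l + t) := by
        rw [← pow_mul, ← pow_add]
        exact pow_dvd_pow _ (by nlinarith)
      have h2 := dvd_sub ih (this.mul_left (qPoch (X ^ m) (X ^ b) (l + t)))
      convert h2 using 1
      ring
  have hlim := (WithPiTopology.tendsto_iff_coeff_tendsto ℤ _ _ _).mp
    (multipliable_qPochInf m hb).hasProd.tendsto_prod_nat
  rw [X_pow_dvd_iff]
  intro n hn
  rw [map_sub, sub_eq_zero]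
  refine tendsto_nhds_unique (hlim n) (tendsto_atTop_of_eventually_const (i₀ := l) fun k hk => ?_)
  obtain ⟨t, rfl⟩ := Nat.exists_eq_add_of_le hk
  have := X_pow_dvd_iff.mp (hstep t) n hn
  rw [map_sub, sub_eq_zero] at this
  exact this

theorem X_pow_dvd_qPochInf_mul_invPoch_sub_one {b p : ℕ} (hb : 0 < b) {l : ℤ}
    (hp : (p : ℤ) ≤ l + 1) :
    (X : ℤ⟦X⟧) ^ p ∣ qPochInf (X ^ b) (X ^ b) * invPoch (X ^ b) l - 1 := by
  rcases lt_or_ge l 0 with hl | hl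
  -- For negative l the reciprocal is 0, but p ≤ l + 1 leaves nothing to prove.
  · obtain rfl : p = 0 := by omega
    simp
  · lift l to ℕ using hl
    rw [← qPoch_mul_invPoch (Q := X ^ b) (by simp [hb.ne']) l, ← sub_mul]
    refine (X_pow_dvd_qPochInf_sub hb ?_).mul_right _
    nlinarith

theorem quotient_mk_eq_iff {p : ℕ} {a c : ℤ⟦X⟧} :
    Ideal.Quotient.mk (Ideal.span {(X : ℤ⟦X⟧) ^ p}) a = Ideal.Quotient.mk (Ideal.span {X ^ p}) c ↔
      X ^ p ∣ a - c := by
  rw [Ideal.Quotient.eq, Ideal.mem_span_singleton]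

theorem X_pow_dvd_qPoch_mul_invPoch_sub_one {b p k : ℕ} (hb : 0 < b) {l₁ l₂ : ℤ}
    (h₁ : (p : ℤ) ≤ l₁ + 1) (h₂ : (p : ℤ) ≤ l₂ + 1) (hk : p ≤ k) {F : ℤ⟦X⟧}
    (hF : X ^ p ∣ qPochInf (X ^ b) (X ^ b) - F) :
    (X : ℤ⟦X⟧) ^ p ∣ F * qPoch (X ^ b) (X ^ b) k * (invPoch (X ^ b) l₁ * invPoch (X ^ b) l₂) - 1 := by
  have h3 := X_pow_dvd_qPochInf_sub (m := b) (l := k) (p := p) hb (by nlinarith)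
  have h1 := X_pow_dvd_qPochInf_mul_invPoch_sub_one hb h₁
  have h2 := X_pow_dvd_qPochInf_mul_invPoch_sub_one hb h₂
  rw [← quotient_mk_eq_iff] at *
  simp only [map_mul] at *
  rw [← hF, ← h3, mul_mul_mul_comm, h1, h2, map_one, one_mul]

theorem natAbs_le_tri {a b : ℕ} (ha : 0 < a) (hb : 0 < b) (j : ℤ) :
    j.natAbs ≤ a * tri j + b * tri (-j) := by
  have h1 := two_mul_tri j
  have h2 := two_mul_tri (-j)
  have h3 : j.natAbs ≤ tri j + tri (-j) := by
    have h4 := Int.natAbs_mul_self' j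
    zify
    rw [← Int.natCast_natAbs]
    have : (j.natAbs : ℤ) ≤ j.natAbs * j.natAbs := by exact_mod_cast Nat.le_mul_self _
    linarith
  nlinarith [Nat.le_mul_of_pos_left (tri j) ha, Nat.le_mul_of_pos_left (tri (-j)) hb]

/-- A Bailey sum agrees up to `q ^ K` with the product side of the Jacobi triple product. -/
theorem X_pow_dvd_sum_theta_sub {a b e : ℕ} (ha : 0 < a) (hb : 0 < b) (he : e ≤ 1) (K : ℕ) :
    (X : ℤ⟦X⟧) ^ K ∣ qPoch X X K *
        ∑ j ∈ Finset.Icc (-K : ℤ) K, theta (X ^ a) (X ^ b) j * baileyKernel e K j -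
      qPochInf (X ^ (a + b)) (X ^ (a + b)) * qPochInf (X ^ a) (X ^ (a + b)) *
        qPochInf (X ^ b) (X ^ (a + b)) * Ring.inverse (qPochInf X X) := by
  have hab : 0 < a + b := by omega
  rw [← isUnit_qPochInf.dvd_mul_left, mul_sub, mul_left_comm (qPochInf X X) _ (Ring.inverse _),
    Ring.mul_inverse_cancel _ isUnit_qPochInf, mul_one]
  have hQ : constantCoeff ((X : ℤ⟦X⟧) ^ a * X ^ b) = 0 := by simp [ha.ne']
  have hJ := finite_jacobi_triple hQ (le_refl K) (le_refl K)
  rw [← pow_add] at hJ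
  -- Compare the Bailey sum with the finite triple product term by term: the two weights of `theta`
  -- agree modulo q^{K-|j|}, and `theta` itself supplies q^{|j|}.
  have h1 : (X : ℤ⟦X⟧) ^ K ∣ qPochInf X X * (qPoch X X K *
        ∑ j ∈ Finset.Icc (-K : ℤ) K, theta (X ^ a) (X ^ b) j * baileyKernel e K j) -
      qPoch (X ^ (a + b)) (X ^ (a + b)) K * (qPoch (X ^ (a + b)) (X ^ (a + b)) (K + K) *
        ∑ j ∈ Finset.Icc (-K : ℤ) K, theta (X ^ a) (X ^ b) j *
          (invPoch (X ^ (a + b)) (K - j) * invPoch (X ^ (a + b)) (K + j))) := by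
    simp_rw [← mul_assoc (qPochInf X X), ← mul_assoc (qPoch (X ^ (a + b)) (X ^ (a + b)) K),
      Finset.mul_sum, ← Finset.sum_sub_distrib]
    refine Finset.dvd_sum fun j hj => ?_
    rw [Finset.mem_Icc] at hj
    obtain ⟨p, hp⟩ : ∃ p, K = j.natAbs + p := Nat.exists_eq_add_of_le (by omega)
    have g1 := X_pow_dvd_qPoch_mul_invPoch_sub_one (b := 1) (p := p) (k := K) one_pos (l₁ := K - j)
      (l₂ := K + j - e) (by omega) (by omega) (by omega) (F := qPochInf X X) (by simp)
    have g2 := X_pow_dvd_qPoch_mul_invPoch_sub_one (b := a + b) (p := p) (k := K + K) hab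
      (l₁ := K - j) (l₂ := K + j) (by omega) (by omega) (by omega)
      (X_pow_dvd_qPochInf_sub (l := K) hab (by have := Nat.le_mul_of_pos_left K hab; omega))
    rw [pow_one] at g1
    have g3 := dvd_sub g1 g2
    have g4 : (X : ℤ⟦X⟧) ^ j.natAbs ∣ theta (X ^ a) (X ^ b) j := by
      rw [theta_X_pow]
      exact (pow_dvd_pow _ (natAbs_le_tri ha hb j)).mul_left _
    have g5 := mul_dvd_mul g4 g3
    rw [← pow_add, ← hp] at g5
    convert g5 using 1
    rw [baileyKernel]
    ring
  rw [hJ] at h1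
  have k0 := X_pow_dvd_qPochInf_sub (m := a + b) (l := K) (p := K) hab (by nlinarith)
  have k1 := X_pow_dvd_qPochInf_sub (m := a) (l := K) (p := K) hab (by nlinarith)
  have k2 := X_pow_dvd_qPochInf_sub (m := b) (l := K) (p := K) hab (by nlinarith)
  rw [← quotient_mk_eq_iff] at *
  rw [h1]
  simp only [map_mul] at *
  rw [k0, k1, k2, mul_assoc]

theorem X_pow_dvd_rectSum_sub_productSide {m i : ℕ} (hm : 0 < m) (K : ℕ) :
    (X : ℤ⟦X⟧) ^ K ∣ qPoch X X K * rectSum m i K - productSide (m + i) i := by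
  have h := X_pow_dvd_sum_theta_sub (b := m + 2 * i + 1) hm (by omega) le_rfl K
  rw [← rectSum_eq le_rfl] at h
  rwa [productSide, Nat.add_sub_cancel, show 2 * (m + i) + 1 = m + (m + 2 * i + 1) by ring,
    show m + i + i + 1 = m + 2 * i + 1 by ring]

/-! ### Partitions inside a rectangle -/

/-- The nonincreasing lists of length `a` with entries at most `b`. -/
def boxLists : ℕ → ℕ → Finset (List ℕ)
  | 0, _ => {[]}
  | a + 1, 0 => (boxLists a 0).image (List.cons 0)
  | a + 1, b + 1 => boxLists (a + 1) b ∪ (boxLists a (b + 1)).image (List.cons (b + 1))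

theorem mem_boxLists {a b : ℕ} {l : List ℕ} :
    l ∈ boxLists a b ↔ l.length = a ∧ (∀ x ∈ l, x ≤ b) ∧ l.Pairwise (· ≥ ·) := by
  induction a, b using boxLists.induct generalizing l with
  | case1 b =>
    rw [boxLists, Finset.mem_singleton, List.length_eq_zero_iff]
    constructor
    · rintro rfl; simp
    · exact fun h => h.1
  | case2 a ih =>
    rw [boxLists, Finset.mem_image]
    constructor
    · rintro ⟨t, ht, rfl⟩
      obtain ⟨h1, h2, h3⟩ := ih.mp ht
      refine ⟨by simp [h1], ?_, ?_⟩
      · simpa using h2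
      · rw [List.pairwise_cons]
        exact ⟨h2, h3⟩
    · rintro ⟨h1, h2, h3⟩
      obtain ⟨x, t, rfl⟩ := List.exists_cons_of_length_eq_add_one h1
      obtain rfl : x = 0 := by simpa using h2 x (by simp)
      exact ⟨t, ih.mpr ⟨by simpa using h1, fun y hy => h2 y (by simp [hy]),
        (List.pairwise_cons.mp h3).2⟩, rfl⟩
  | case3 a b ih1 ih2 =>
    rw [boxLists, Finset.mem_union, Finset.mem_image, ih1]
    constructor
    · rintro (⟨h1, h2, h3⟩ | ⟨t, ht, rfl⟩)
      · exact ⟨h1, fun x hx => (h2 x hx).trans (Nat.le_succ b), h3⟩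
      · obtain ⟨h1, h2, h3⟩ := ih2.mp ht
        refine ⟨by simp [h1], ?_, ?_⟩
        · simpa using h2
        · rw [List.pairwise_cons]
          exact ⟨h2, h3⟩
    · rintro ⟨h1, h2, h3⟩
      obtain ⟨x, t, rfl⟩ := List.exists_cons_of_length_eq_add_one h1
      rcases Nat.lt_or_ge b x with h | h
      · obtain rfl : x = b + 1 := le_antisymm (h2 x (by simp)) h
        exact Or.inr ⟨t, ih2.mpr ⟨by simpa using h1, fun y hy => h2 y (by simp [hy]),
          (List.pairwise_cons.mp h3).2⟩, rfl⟩
      · refine Or.inl ⟨h1, fun y hy => ?_, h3⟩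
        rcases List.mem_cons.mp hy with rfl | hy
        · exact h
        · exact ((List.pairwise_cons.mp h3).1 y hy).trans h

/-- The generating function of a finite set of lists by their sum. -/
noncomputable def listGenFun (S : Finset (List ℕ)) : ℤ⟦X⟧ := ∑ l ∈ S, X ^ l.sum

theorem listGenFun_image_cons (c : ℕ) (S : Finset (List ℕ)) :
    listGenFun (S.image (List.cons c)) = X ^ c * listGenFun S := by
  rw [listGenFun, Finset.sum_image (fun _ _ _ _ h => (List.cons.inj h).2), listGenFun,
    Finset.mul_sum]
  exact Finset.sum_congr rfl fun l _ => by rw [List.sum_cons, pow_add]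

theorem coeff_listGenFun (S : Finset (List ℕ)) (n : ℕ) :
    coeff n (listGenFun S) = ((S.filter fun l => l.sum = n).card : ℤ) := by
  rw [listGenFun, map_sum, Finset.card_filter]
  push_cast
  refine Finset.sum_congr rfl fun l _ => ?_
  rw [coeff_X_pow]
  simp only [eq_comm]

/-- The box is counted by a Gaussian binomial. Its Pascal recursion, according to whether the first
entry is b + 1, matches 1 - q^{a+b+2} = (1 - q^{b+1}) + q^{b+1}(1 - q^{a+1}). -/
theorem invPoch_mul_listGenFun_boxLists (a b : ℕ) :
    invPoch X ((a + b : ℕ) : ℤ) * listGenFun (boxLists a b) = invPoch X a * invPoch X b := by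
  induction a, b using boxLists.induct with
  | case1 b => simp [boxLists, listGenFun, invPoch_zero]
  | case2 a ih =>
    have hX : constantCoeff (X : ℤ⟦X⟧) = 0 := by simp
    have h : listGenFun (boxLists a 0) = 1 := by
      have h1 := qPoch_mul_invPoch hX a
      simp only [add_zero, Nat.cast_zero, invPoch_zero, mul_one] at ih
      linear_combination qPoch X X a * ih + (1 - listGenFun (boxLists a 0)) * h1
    rw [boxLists, listGenFun_image_cons, h]
    simp [invPoch_zero]
  | case3 a b ih1 ih2 =>
    have hX : constantCoeff (X : ℤ⟦X⟧) = 0 := by simp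
    have hdisj : Disjoint (boxLists (a + 1) b) ((boxLists a (b + 1)).image (List.cons (b + 1))) := by
      rw [Finset.disjoint_left]
      intro l hl hl'
      obtain ⟨t, -, rfl⟩ := Finset.mem_image.mp hl'
      have := (mem_boxLists.mp hl).2.1 (b + 1) (by simp)
      omega
    have hu : listGenFun (boxLists (a + 1) (b + 1)) = listGenFun (boxLists (a + 1) b) +
        X ^ (b + 1) * listGenFun (boxLists a (b + 1)) := by
      rw [← listGenFun_image_cons, boxLists, listGenFun, Finset.sum_union hdisj]
      rfl
    apply mul_left_cancel₀ (one_sub_X_pow_ne_zero (n := a + 1 + (b + 1)) (by omega))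
    have h1 := one_sub_pow_mul_invPoch hX (a + 1 + (b + 1))
    have h2 := one_sub_pow_mul_invPoch hX (a + 1)
    have h3 := one_sub_pow_mul_invPoch hX (b + 1)
    have e1 : ((a + 1 + (b + 1) : ℕ) : ℤ) - 1 = (a + 1 + b : ℕ) := by omega
    have e2 : ((a + 1 : ℕ) : ℤ) - 1 = a := by omega
    have e3 : ((b + 1 : ℕ) : ℤ) - 1 = b := by omega
    rw [e1] at h1
    rw [e2] at h2
    rw [e3] at h3
    rw [show a + (b + 1) = a + 1 + b by ring] at ih2
    rw [← mul_assoc, h1, hu, mul_add, ih1, mul_left_comm, ih2, ← h2, ← h3, pow_add X (a + 1)]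
    ring

/-! ### Dissections of lists -/

/-- The largest `k` such that the rectangle with `k` columns and `k - e` rows fits. -/
def durfee (e : ℕ) (l : List ℕ) : ℕ :=
  Nat.findGreatest (fun k => ∀ j < k - e, k ≤ l.getD j 0) (l.length + e)

/-- The rows below the rectangle of width `durfee e l`. -/
def below (e : ℕ) (l : List ℕ) : List ℕ := l.drop (durfee e l - e)

theorem below_zero : below 0 = belowSquare := rfl

theorem below_one : below 1 = belowRectangle := rfl

/-- A wider rectangle would have to include the first row of b, which is too short. This makes the
decomposition into rectangle, right part and lower part unique. -/
theorem durfee_append {e k : ℕ} {t b : List ℕ} (hk : t.length + e = k) (ht : ∀ x ∈ t, k ≤ x)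
    (hb : ∀ x ∈ b, x ≤ k) : durfee e (t ++ b) = k := by
  rw [durfee, Nat.findGreatest_eq_iff]
  refine ⟨by simp; omega, fun _ j hj => ?_, fun n hn hn' h => ?_⟩
  · have hj' : j < t.length := by omega
    rw [List.getD_append _ _ _ _ hj', List.getD_eq_getElem _ _ hj']
    exact ht _ (List.getElem_mem _)
  · have h1 := h t.length (by omega)
    rw [List.getD_append_right _ _ _ _ le_rfl, Nat.sub_self] at h1
    rcases b with _ | ⟨x, b⟩
    · simp at h1; omega
    · have := hb x (by simp)
      simp at h1
      omega

theorem durfee_spec {e : ℕ} {l : List ℕ} (hl : l.Pairwise (· ≥ ·)) :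
    e ≤ durfee e l ∧ durfee e l - e ≤ l.length ∧
      (∀ x ∈ l.take (durfee e l - e), durfee e l ≤ x) ∧
        ∀ x ∈ l.drop (durfee e l - e), x ≤ durfee e l := by
  set P : ℕ → Prop := fun k => ∀ j < k - e, k ≤ l.getD j 0 with hP
  have hPe : P e := by intro j hj; omega
  have h1 : e ≤ durfee e l := Nat.le_findGreatest (by omega) hPe
  have h2 : durfee e l ≤ l.length + e := Nat.findGreatest_le _
  have h3 : P (durfee e l) := Nat.findGreatest_spec (P := P) (m := e) (by omega) hPe
  refine ⟨h1, by omega, ?_, ?_⟩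
  · intro x hx
    obtain ⟨j, hj, rfl⟩ := List.mem_take_iff_getElem.mp hx
    have h4 := h3 j (by omega)
    rwa [List.getD_eq_getElem _ _ (by omega)] at h4
  · intro x hx
    obtain ⟨j, hj, rfl⟩ := List.mem_drop_iff_getElem.mp hx
    by_contra! hlt
    refine Nat.findGreatest_is_greatest (P := P) (Nat.lt_succ_self (durfee e l)) (by omega) ?_
    intro i hi
    rw [List.getD_eq_getElem _ _ (by omega)]
    rcases Nat.eq_or_lt_of_le (show i ≤ durfee e l - e + j by omega) with h | h
    · simp only [h]; exact hlt
    · exact le_trans hlt (List.pairwise_iff_getElem.mp hl i _ (by omega) (by omega) h)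

/-- The list of parts of a partition with all parts at most `N`. -/
def IsPartList (N : ℕ) (l : List ℕ) : Prop := l.Pairwise (· ≥ ·) ∧ ∀ x ∈ l, 0 < x ∧ x ≤ N

/-- The lists obtained by putting a rectangle with `k` columns and `k - e` rows, `e ≤ k ≤ N`, on top
of an element of `S k` and extending its rows to length at most `N`. -/
def dissectionStep (e : ℕ) (S : ℕ → Finset (List ℕ)) (N : ℕ) : Finset (List ℕ) :=
  ((Finset.Icc e N).sigma fun k => boxLists (k - e) (N - k) ×ˢ S k).image
    fun p => p.2.1.map (· + p.1) ++ p.2.2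

theorem mem_dissectionStep {e : ℕ} {S : ℕ → Finset (List ℕ)} {Q : List ℕ → Prop}
    (hS : ∀ k, e ≤ k → ∀ l, l ∈ S k ↔ IsPartList k l ∧ Q l) {N : ℕ} (hN : e ≤ N) (l : List ℕ) :
    l ∈ dissectionStep e S N ↔ IsPartList N l ∧ Q (below e l) := by
  simp only [dissectionStep, Finset.mem_image, Finset.mem_sigma, Finset.mem_product, Finset.mem_Icc]
  constructor
  · rintro ⟨⟨k, t, b⟩, ⟨⟨hek, hkN⟩, ht, hb⟩, rfl⟩
    dsimp only at *
    obtain ⟨ht1, ht2, ht3⟩ := mem_boxLists.mp ht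
    obtain ⟨⟨hb1, hb2⟩, hbQ⟩ := (hS k hek b).mp hb
    have hlen : (t.map (· + k)).length + e = k := by rw [List.length_map]; omega
    have hge : ∀ x ∈ t.map (· + k), k ≤ x := by simp
    have hd : durfee e (t.map (· + k) ++ b) = k := durfee_append hlen hge fun x hx => (hb2 x hx).2
    refine ⟨⟨?_, ?_⟩, ?_⟩
    · rw [List.pairwise_append]
      refine ⟨?_, hb1, fun x hx y hy => (hb2 y hy).2.trans (hge x hx)⟩
      rw [List.pairwise_map]
      exact ht3.imp fun h => Nat.add_le_add_right h k
    · intro x hx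
      rcases List.mem_append.mp hx with hx | hx
      -- A row exists beside the rectangle only if k > e, so k > 0 and the extended part is positive
      -- even when its extension is 0.
      · have h0 := List.length_pos_of_mem hx
        obtain ⟨y, hy, rfl⟩ := List.mem_map.mp hx
        have := ht2 y hy
        omega
      · have := hb2 x hx
        omega
    · rw [below, hd, List.drop_left' (by omega)]
      exact hbQ
  · rintro ⟨⟨hl1, hl2⟩, hQ⟩
    obtain ⟨h1, h2, h3, h4⟩ := durfee_spec (e := e) hl1
    -- Either the rectangle has no rows and its width is e ≤ N, or its width is at most the first
    -- part.
    have hkN : durfee e l ≤ N := by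
      rcases Nat.eq_zero_or_pos (durfee e l - e) with h | h
      · omega
      · have hm : l[0]'(by omega) ∈ l.take (durfee e l - e) :=
          List.mem_take_iff_getElem.mpr ⟨0, by omega, rfl⟩
        exact (h3 _ hm).trans (hl2 _ (List.mem_of_mem_take hm)).2
    refine ⟨⟨durfee e l, (l.take (durfee e l - e)).map (· - durfee e l), below e l⟩,
      ⟨⟨h1, hkN⟩, mem_boxLists.mpr ⟨?_, ?_, ?_⟩, (hS _ h1 _).mpr ⟨⟨?_, ?_⟩, hQ⟩⟩, ?_⟩
    · simp; omega
    · intro x hx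
      obtain ⟨y, hy, rfl⟩ := List.mem_map.mp hx
      exact Nat.sub_le_sub_right (hl2 y (List.mem_of_mem_take hy)).2 _
    · rw [List.pairwise_map]
      exact (hl1.sublist (List.take_sublist _ _)).imp fun h => Nat.sub_le_sub_right h _
    · exact hl1.sublist (List.drop_sublist _ _)
    · exact fun x hx => ⟨(hl2 x (List.mem_of_mem_drop hx)).1, h4 x hx⟩
    · dsimp only
      rw [List.map_map, below]
      conv_rhs => rw [← List.take_append_drop (durfee e l - e) l]
      congr 1
      conv_rhs => rw [← List.map_id (l.take (durfee e l - e))]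
      refine List.map_congr_left fun x hx => ?_
      have := h3 x hx
      simp
      omega

theorem sum_map_add_const (t : List ℕ) (k : ℕ) :
    (t.map (· + k)).sum = t.length * k + t.sum := by
  induction t with
  | nil => simp
  | cons x t ih => simp [ih]; ring

theorem listGenFun_dissectionStep {e : ℕ} {S : ℕ → Finset (List ℕ)}
    (hS : ∀ k, ∀ l ∈ S k, ∀ x ∈ l, x ≤ k) (N : ℕ) :
    listGenFun (dissectionStep e S N) = ∑ k ∈ Finset.Icc e N,
      X ^ (k * (k - e)) * (listGenFun (boxLists (k - e) (N - k)) * listGenFun (S k)) := by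
  rw [listGenFun, dissectionStep, Finset.sum_image, Finset.sum_sigma]
  · refine Finset.sum_congr rfl fun k _ => ?_
    rw [Finset.sum_product, listGenFun, listGenFun, Finset.sum_mul_sum, Finset.mul_sum]
    refine Finset.sum_congr rfl fun t ht => ?_
    rw [Finset.mul_sum]
    refine Finset.sum_congr rfl fun b _ => ?_
    rw [List.sum_append, sum_map_add_const, (mem_boxLists.mp ht).1, ← pow_add, ← pow_add]
    congr 1
    ring
  · have key : ∀ p ∈ ((Finset.Icc e N).sigma fun k => boxLists (k - e) (N - k) ×ˢ S k),
        (p.2.1.map (· + p.1)).length + e = p.1 ∧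
          durfee e (p.2.1.map (· + p.1) ++ p.2.2) = p.1 := by
      rintro ⟨k, t, b⟩ hp
      simp only [Finset.mem_sigma, Finset.mem_product, Finset.mem_Icc] at hp
      have hlen : (t.map (· + k)).length + e = k := by
        rw [List.length_map, (mem_boxLists.mp hp.2.1).1]; omega
      exact ⟨hlen, durfee_append hlen (by simp) (hS k b hp.2.2)⟩
    rintro ⟨k, t, b⟩ hp ⟨k', t', b'⟩ hp' heq
    obtain ⟨h1, h2⟩ := key _ hp
    obtain ⟨h1', h2'⟩ := key _ hp'
    dsimp only at *
    obtain rfl : k = k' := by rw [← h2, ← h2', heq]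
    obtain ⟨ht, rfl⟩ := List.append_inj heq (by omega)
    rw [List.map_injective_iff.mpr (add_left_injective k) ht]

/-- The Gaussian binomial (q)_{N-e}/((q)_{k-e}(q)_{N-k}) carries exactly the normalizations needed
to iterate the step. -/
theorem invPoch_mul_listGenFun_dissectionStep {e : ℕ} {S : ℕ → Finset (List ℕ)}
    (hS : ∀ k, ∀ l ∈ S k, ∀ x ∈ l, x ≤ k) (N : ℕ) :
    invPoch X (N - e) * listGenFun (dissectionStep e S N) =
      baileyStep e (fun k => invPoch X (k - e) * listGenFun (S k)) N := by
  have hsub : Finset.Icc e N ⊆ Finset.range (N + 1) := by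
    intro k hk
    simp at hk ⊢
    omega
  rw [listGenFun_dissectionStep hS, baileyStep, Finset.mul_sum, ← Finset.sum_subset hsub]
  · refine Finset.sum_congr rfl fun k hk => ?_
    rw [Finset.mem_Icc] at hk
    have h := invPoch_mul_listGenFun_boxLists (k - e) (N - k)
    have e1 : ((k - e + (N - k) : ℕ) : ℤ) = N - e := by omega
    have e2 : ((k - e : ℕ) : ℤ) = k - e := by omega
    have e3 : ((N - k : ℕ) : ℤ) = N - k := by omega
    rw [e1, e2, e3] at h
    linear_combination X ^ (k * (k - e)) * listGenFun (S k) * h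
  -- Widths k < e are not drawn, and 1/(q)_{k-e} = 0 removes them from the Bailey step.
  · intro k hk hk'
    have : k < e := by
      simp at hk hk'
      omega
    rw [invPoch_of_neg X (n := k - e) (by omega)]
    simp

/-- The partitions with parts at most `N` dissected by `m` successive Durfee squares. -/
def squareLists (m : ℕ) : ℕ → Finset (List ℕ) := (dissectionStep 0)^[m] fun _ => {[]}

/-- The partitions with parts at most `N` dissected by `i` successive horizontal Durfee rectangles
followed by `m` successive Durfee squares. -/
def rectLists (m i : ℕ) : ℕ → Finset (List ℕ) := (dissectionStep 1)^[i] (squareLists m)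

theorem mem_squareLists (m N : ℕ) (l : List ℕ) :
    l ∈ squareLists m N ↔ IsPartList N l ∧ belowSquare^[m] l = [] := by
  induction m generalizing N l with
  | zero =>
    simp only [squareLists, Function.iterate_zero, id, Finset.mem_singleton]
    exact ⟨by rintro rfl; simp [IsPartList], fun h => h.2⟩
  | succ m ih =>
    rw [squareLists, Function.iterate_succ_apply', Function.iterate_succ_apply, ← below_zero]
    exact mem_dissectionStep (fun k _ => ih k) (Nat.zero_le N) l

/-- N = 0 must be excluded: a rectangle has at least one column, so for i > 0 the set at N = 0 is
empty and misses the empty partition. -/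
theorem mem_rectLists (m i : ℕ) {N : ℕ} (hN : 1 ≤ N) (l : List ℕ) :
    l ∈ rectLists m i N ↔ IsPartList N l ∧ belowSquare^[m] (belowRectangle^[i] l) = [] := by
  induction i generalizing N l with
  | zero => exact mem_squareLists m N l
  | succ i ih =>
    rw [rectLists, Function.iterate_succ_apply', Function.iterate_succ_apply, ← below_one]
    exact mem_dissectionStep (Q := fun l => belowSquare^[m] (belowRectangle^[i] l) = [])
      (fun k hk => ih hk) hN l

/-- The first step, applied to the unit sequence, only produces 1/(q)_N, so m + 1 steps correspond
to m squares. -/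
theorem squareSum_eq_listGenFun (m N : ℕ) :
    squareSum (m + 1) N = invPoch X N * listGenFun (squareLists m N) := by
  induction m generalizing N with
  | zero =>
    have h : squareSum 1 N = baileyStep 0 (fun N => if N = 0 then 1 else 0) N := rfl
    rw [h, baileyStep, Finset.sum_eq_single 0]
    · simp [squareLists, listGenFun]
    · intro k _ hk
      simp [hk]
    · simp
  | succ m ih =>
    have h : squareLists (m + 1) N = dissectionStep 0 (squareLists m) N := by
      rw [squareLists, Function.iterate_succ_apply']; rfl
    have h' := invPoch_mul_listGenFun_dissectionStep (e := 0) (S := squareLists m)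
      (fun k l hl x hx => (((mem_squareLists m k l).mp hl).1.2 x hx).2) N
    simp only [Nat.cast_zero, sub_zero] at h'
    rw [h, h', squareSum, Function.iterate_succ_apply']
    exact congrArg (fun f => baileyStep 0 f N) (funext ih)

theorem le_of_mem_rectLists (m i : ℕ) : ∀ k, ∀ l ∈ rectLists m i k, ∀ x ∈ l, x ≤ k := by
  intro k l hl x hx
  rcases i with _ | i
  · exact (((mem_squareLists m k l).mp hl).1.2 x hx).2
  · rcases Nat.eq_zero_or_pos k with rfl | hk
    · rw [rectLists, Function.iterate_succ_apply'] at hl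
      simp [dissectionStep] at hl
    · exact (((mem_rectLists m _ hk l).mp hl).1.2 x hx).2

theorem rectSum_eq_listGenFun (m i N : ℕ) :
    rectSum (m + 1) i N = invPoch X (N - 1) * listGenFun (rectLists m i N) := by
  induction i generalizing N with
  | zero =>
    have h : rectSum (m + 1) 0 N = (1 - X ^ N) * squareSum (m + 1) N := rfl
    rw [h, squareSum_eq_listGenFun, ← mul_assoc, one_sub_pow_mul_invPoch (by simp)]
    rfl
  | succ i ih =>
    have h : rectLists m (i + 1) N = dissectionStep 1 (rectLists m i) N := by
      rw [rectLists, Function.iterate_succ_apply']; rfl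
    have h' := invPoch_mul_listGenFun_dissectionStep (e := 1) (le_of_mem_rectLists m i) N
    simp only [Nat.cast_one] at h'
    rw [h, h', rectSum, Function.iterate_succ_apply']
    exact congrArg (fun f => baileyStep 1 f N) (funext ih)

theorem card_durfeePartitions (m i n : ℕ) {K : ℕ} (hn : n < K) :
    ((durfeePartitions (m + 1 + i) (m + 1) n).card : ℤ) =
      coeff n (listGenFun (rectLists m i K)) := by
  rw [coeff_listGenFun]
  congr 1
  rw [durfeePartitions, show m + 1 + i - (m + 1) = i by omega, Nat.add_sub_cancel]
  refine Finset.card_bij (fun p _ => p.parts.sort (· ≥ ·)) ?_ ?_ ?_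
  · intro p hp
    rw [Finset.mem_filter, mem_rectLists m i (by omega)]
    refine ⟨⟨⟨Multiset.pairwise_sort _ _, fun x hx => ?_⟩, (Finset.mem_filter.mp hp).2⟩, ?_⟩
    · rw [Multiset.mem_sort] at hx
      exact ⟨p.parts_pos hx, (p.le_of_mem_parts hx).trans hn.le⟩
    · rw [← Multiset.sum_coe, Multiset.sort_eq, p.parts_sum]
  · intro p _ p' _ h
    ext1
    rw [← Multiset.sort_eq p.parts (· ≥ ·), h, Multiset.sort_eq]
  · intro l hl
    rw [Finset.mem_filter, mem_rectLists m i (by omega)] at hl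
    obtain ⟨⟨⟨h1, h2⟩, h3⟩, h4⟩ := hl
    have hs : (l : Multiset ℕ).sort (· ≥ ·) = l := by
      rw [Multiset.coe_sort]
      exact List.mergeSort_eq_self _ (by simpa using h1)
    refine ⟨⟨(l : Multiset ℕ), fun hx => (h2 _ (by simpa using hx)).1, by simpa using h4⟩, ?_, hs⟩
    rw [Finset.mem_filter, hs]
    exact ⟨Finset.mem_univ _, h3⟩

/-- With K = n + 1, the quotient (q)_K/(q)_{K-1} = 1 - q^K does not affect the coefficient of q^n,
and bounding the parts by K does not restrict partitions of n. -/
theorem coeff_productSide (m i n : ℕ) :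
    coeff n (productSide (m + 1 + i) i) =
      ((durfeePartitions (m + 1 + i) (m + 1) n).card : ℤ) := by
  rw [card_durfeePartitions m i n (Nat.lt_succ_self n)]
  have hX : constantCoeff (X : ℤ⟦X⟧) = 0 := by simp
  have h := X_pow_dvd_rectSum_sub_productSide (m := m + 1) (i := i) (by omega) (n + 1)
  rw [rectSum_eq_listGenFun, ← one_sub_pow_mul_invPoch hX, mul_assoc,
    mul_left_comm (qPoch _ _ _), ← mul_assoc (qPoch _ _ _), qPoch_mul_invPoch hX, one_mul] at h
  have h' := dvd_add h (Dvd.intro (listGenFun (rectLists m i (n + 1))) rfl)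
  have := X_pow_dvd_iff.mp h' n (Nat.lt_succ_self n)
  have e : (1 - X ^ (n + 1)) * listGenFun (rectLists m i (n + 1)) - productSide (m + 1 + i) i +
      X ^ (n + 1) * listGenFun (rectLists m i (n + 1)) =
      listGenFun (rectLists m i (n + 1)) - productSide (m + 1 + i) i := by ring
  rw [e, map_sub, sub_eq_zero] at this
  exact this.symm

/-! ### The multiple sum over tuples -/

theorem entry_cons_zero {m : ℕ} (a : ℕ) (s : Fin m → ℕ) :
    entry (Fin.cons a s : Fin (m + 1) → ℕ) 0 = a := by
  simp [entry]

theorem entry_cons_succ {m : ℕ} (a : ℕ) (s : Fin m → ℕ) (j : ℕ) :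
    entry (Fin.cons a s : Fin (m + 1) → ℕ) (j + 1) = entry s j := by
  unfold entry
  by_cases h : j < m
  · rw [dif_pos h, dif_pos (by omega)]
    exact Fin.cons_succ (α := fun _ => ℕ) a s ⟨j, h⟩
  · rw [dif_neg h, dif_neg (by omega)]

theorem entry_of_le {m j : ℕ} (h : m ≤ j) (s : Fin m → ℕ) : entry s j = 0 :=
  dif_neg (by omega)

theorem entry_val {m : ℕ} (s : Fin m → ℕ) (a : Fin m) : entry s a = s a :=
  dif_pos a.2

/-- The term `q^{s_1^2 + ⋯ + s_m^2 - s_1 - ⋯ - s_i} / ((q)_{s_1-s_2} ⋯ (q)_{s_m})`, which is `0` if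
the tuple `s` is not nonincreasing. -/
noncomputable def tupleTerm {m : ℕ} (i : ℕ) (s : Fin m → ℕ) : ℤ⟦X⟧ :=
  X ^ (∑ j ∈ Finset.range m, entry s j * (entry s j - if j < i then 1 else 0)) *
    ∏ j ∈ Finset.range m, invPoch X ((entry s j : ℤ) - entry s (j + 1))

theorem tupleTerm_cons_zero {m : ℕ} (a : ℕ) (s : Fin m → ℕ) :
    tupleTerm 0 (Fin.cons a s : Fin (m + 1) → ℕ) =
      X ^ (a * (a - 0)) * invPoch X (a - entry s 0) * tupleTerm 0 s := by
  simp only [tupleTerm, Finset.sum_range_succ', Finset.prod_range_succ', entry_cons_succ,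
    entry_cons_zero, Nat.not_lt_zero, if_false]
  rw [pow_add]
  ring

theorem tupleTerm_cons_succ {m : ℕ} (i a : ℕ) (s : Fin m → ℕ) :
    tupleTerm (i + 1) (Fin.cons a s : Fin (m + 1) → ℕ) =
      X ^ (a * (a - 1)) * invPoch X (a - entry s 0) * tupleTerm i s := by
  simp only [tupleTerm, Finset.sum_range_succ', Finset.prod_range_succ', entry_cons_succ,
    entry_cons_zero, Nat.zero_lt_succ, if_true, Nat.succ_lt_succ_iff]
  rw [pow_add]
  ring

theorem sum_piFinset_cons {R : Type*} [AddCommMonoid R] (m : ℕ) (S : Finset ℕ)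
    (F : (Fin (m + 1) → ℕ) → R) :
    ∑ s ∈ Fintype.piFinset (fun _ : Fin (m + 1) => S), F s =
      ∑ a ∈ S, ∑ s ∈ Fintype.piFinset (fun _ : Fin m => S), F (Fin.cons a s) := by
  rw [← Finset.sum_product']
  refine Finset.sum_nbij' (fun s => (s 0, Fin.tail s)) (fun p => Fin.cons p.1 p.2) ?_ ?_ ?_ ?_ ?_
  · intro s hs
    rw [Fintype.mem_piFinset] at hs
    exact Finset.mem_product.mpr ⟨hs 0, Fintype.mem_piFinset.mpr fun j => hs j.succ⟩
  · intro p hp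
    obtain ⟨h1, h2⟩ := Finset.mem_product.mp hp
    rw [Fintype.mem_piFinset] at h2 ⊢
    exact Fin.cases h1 h2
  · intro s _
    exact Fin.cons_self_tail s
  · intro p _
    simp
  · intro s _
    rw [Fin.cons_self_tail]

theorem baileyStep_eq_sum_range {e N K : ℕ} (h : N ≤ K) (f : ℕ → ℤ⟦X⟧) : baileyStep e f N =
    ∑ s ∈ Finset.range (K + 1), X ^ (s * (s - e)) * invPoch X (N - s) * f s := by
  refine Finset.sum_subset (Finset.range_mono (by omega)) fun s _ hs => ?_
  rw [Finset.mem_range] at hs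
  rw [invPoch_of_neg X (n := N - s) (by omega)]
  simp

theorem squareSum_eq_sum_tupleTerm (m : ℕ) {N K : ℕ} (h : N ≤ K) : squareSum (m + 1) N =
    ∑ s ∈ Fintype.piFinset (fun _ : Fin m => Finset.range (K + 1)),
      invPoch X (N - entry s 0) * tupleTerm 0 s := by
  induction m generalizing N with
  | zero =>
    simp [squareSum_eq_listGenFun, squareLists, listGenFun, tupleTerm, entry]
  | succ m ih =>
    rw [squareSum, Function.iterate_succ_apply', ← squareSum, baileyStep_eq_sum_range h,
      sum_piFinset_cons]
    refine Finset.sum_congr rfl fun a ha => ?_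
    rw [ih (N := a) (by simp at ha; omega), Finset.mul_sum]
    refine Finset.sum_congr rfl fun s _ => ?_
    rw [tupleTerm_cons_zero, entry_cons_zero]
    ring

/-- Prepending s_0 = N treats all i uniformly. For i = 0 the factor is 1 - q^N, which tends to 1;
this is why it is omitted in the limit. -/
theorem rectSum_eq_sum_tupleTerm (m i : ℕ) {N K : ℕ} (h : N ≤ K) : rectSum (m + 1) i N =
    ∑ s ∈ Fintype.piFinset (fun _ : Fin (m + i) => Finset.range (K + 1)),
      invPoch X (N - entry s 0) * ((1 - X ^ entry (Fin.cons N s : Fin (m + i + 1) → ℕ) i) *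
        tupleTerm i s) := by
  induction i generalizing N with
  | zero =>
    have h0 : rectSum (m + 1) 0 N = (1 - X ^ N) * squareSum (m + 1) N := rfl
    rw [h0, squareSum_eq_sum_tupleTerm m h, Finset.mul_sum]
    refine Finset.sum_congr rfl fun s _ => ?_
    rw [entry_cons_zero]
    ring
  | succ i ih =>
    rw [rectSum, Function.iterate_succ_apply', ← rectSum, baileyStep_eq_sum_range h,
      ← add_assoc, sum_piFinset_cons]
    refine Finset.sum_congr rfl fun a ha => ?_
    rw [ih (N := a) (by simp at ha; omega), Finset.mul_sum]
    refine Finset.sum_congr rfl fun s _ => ?_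
    rw [tupleTerm_cons_succ, entry_cons_zero, entry_cons_succ]
    ring

theorem prod_invPoch_eq_zero_of_not_antitone {m : ℕ} {s : Fin m → ℕ} (hs : ¬ Antitone s) :
    ∏ j ∈ Finset.range m, invPoch X ((entry s j : ℤ) - entry s (j + 1)) = 0 := by
  by_contra hne
  have h : Antitone (entry s) := by
    refine antitone_nat_of_succ_le fun j => ?_
    rcases lt_or_ge j m with hj | hj
    · by_contra hlt
      exact hne (Finset.prod_eq_zero (Finset.mem_range.mpr hj) (invPoch_of_neg X (by omega)))
    · rw [entry_of_le (by omega)]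
      exact Nat.zero_le _
  refine hs fun a b hab => ?_
  rw [← entry_val s a, ← entry_val s b]
  exact h hab

theorem antitone_entry {m : ℕ} {s : Fin m → ℕ} (hs : Antitone s) : Antitone (entry s) := by
  intro a b hab
  unfold entry
  by_cases hb : b < m
  · rw [dif_pos hb, dif_pos (by omega)]
    exact hs hab
  · rw [dif_neg hb]
    exact Nat.zero_le _

theorem exponent_eq {m i : ℕ} (hi : i ≤ m) (s : Fin m → ℕ) : exponent i s =
    ∑ j ∈ Finset.range m, entry s j * (entry s j - if j < i then 1 else 0) := by
  obtain ⟨k, rfl⟩ := Nat.exists_eq_add_of_le hi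
  rw [exponent, Nat.sub_eq_iff_eq_add (exponent_sub_le hi s), Finset.sum_range_add,
    Finset.sum_range_add _ i k, add_right_comm, ← Finset.sum_add_distrib]
  congr 1
  · refine Finset.sum_congr rfl fun j hj => ?_
    rw [if_pos (Finset.mem_range.mp hj)]
    rcases entry s j with _ | x
    · rfl
    · rw [Nat.add_sub_cancel]; ring
  · refine Finset.sum_congr rfl fun j _ => ?_
    rw [if_neg (by omega), Nat.sub_zero, sq]

theorem summand_eq_tupleTerm {m i : ℕ} (hi : i ≤ m) {s : Fin m → ℕ} (hs : Antitone s) :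
    summand i s = (if i = 0 then 1 else 1 - X ^ entry s (i - 1)) * tupleTerm i s := by
  have hinv : Ring.inverse (∏ j ∈ Finset.range m, qPoch X X (entry s j - entry s (j + 1))) =
      ∏ j ∈ Finset.range m, invPoch X ((entry s j : ℤ) - entry s (j + 1)) := by
    have h : (∏ j ∈ Finset.range m, qPoch X X (entry s j - entry s (j + 1))) *
        ∏ j ∈ Finset.range m, invPoch X ((entry s j : ℤ) - entry s (j + 1)) = 1 := by
      rw [← Finset.prod_mul_distrib]
      refine Finset.prod_eq_one fun j _ => ?_
      rw [← Nat.cast_sub (antitone_entry hs (Nat.le_succ j))]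
      exact qPoch_mul_invPoch (by simp) _
    rw [← Ring.inverse_mul_cancel_left _ (∏ j ∈ Finset.range m, invPoch X _)
      (IsUnit.of_mul_eq_one _ h), h, mul_one]
  rw [summand, tupleTerm, hinv, exponent_eq hi]
  ring

theorem X_pow_dvd_tupleTerm {m : ℕ} (i : ℕ) (s : Fin m → ℕ) :
    (X : ℤ⟦X⟧) ^ (entry s 0 * (entry s 0 - 1)) ∣ tupleTerm i s := by
  refine (pow_dvd_pow X ?_).mul_right _
  rcases Nat.eq_zero_or_pos m with rfl | hm
  · simp [entry]
  · exact le_trans (Nat.mul_le_mul_left _ (by split_ifs <;> omega))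
      (Finset.single_le_sum (f := fun j => entry s j * (entry s j - if j < i then 1 else 0))
        (fun _ _ => Nat.zero_le _) (Finset.mem_range.mpr hm))

/-- The terms of the truncated sum stabilize. -/
theorem X_pow_dvd_truncated_sub {m : ℕ} (i K : ℕ) (s : Fin m → ℕ) :
    (X : ℤ⟦X⟧) ^ K ∣ qPoch X X K * (invPoch X (K - entry s 0) *
        ((1 - X ^ entry (Fin.cons K s : Fin (m + 1) → ℕ) i) * tupleTerm i s)) -
      (if i = 0 then 1 else 1 - X ^ entry s (i - 1)) * tupleTerm i s := by
  have hT := X_pow_dvd_tupleTerm i s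
  have h1 : (X : ℤ⟦X⟧) ^ K ∣ (qPoch X X K * invPoch X (K - entry s 0) - 1) * tupleTerm i s := by
    rcases lt_or_ge K (entry s 0) with hK | hK
    · refine ((pow_dvd_pow X ?_).trans hT).mul_left _
      have : K ≤ entry s 0 - 1 := by omega
      exact this.trans (Nat.le_mul_of_pos_left _ (by omega))
    · obtain ⟨p, hp⟩ := Nat.exists_eq_add_of_le hK
      have g1 := X_pow_dvd_qPochInf_mul_invPoch_sub_one (b := 1) (p := p + 1) one_pos
        (l := K - entry s 0) (by omega)
      have g2 := X_pow_dvd_qPochInf_sub (m := 1) (b := 1) (l := K) (p := p + 1) one_pos (by omega)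
      rw [pow_one] at g1 g2
      have g3 := dvd_sub g1 (g2.mul_right (invPoch X (K - entry s 0)))
      have g4 := mul_dvd_mul g3 hT
      rw [← pow_add] at g4
      -- Here p = K - s_1, and the bound is s_1 ≤ 1 + s_1(s_1 - 1), i.e. (s_1 - 1)² ≥ 0.
      have e : K ≤ p + 1 + entry s 0 * (entry s 0 - 1) := by
        rcases h : entry s 0 with _ | x
        · omega
        · rw [Nat.add_sub_cancel]
          nlinarith [Nat.le_mul_self x]
      convert (pow_dvd_pow X e).trans g4 using 1
      ring
  rcases i with _ | i
  · rw [entry_cons_zero, if_pos rfl]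
    have h2 : (X : ℤ⟦X⟧) ^ K ∣ X ^ K * (qPoch X X K * invPoch X (K - entry s 0) * tupleTerm 0 s) :=
      Dvd.intro _ rfl
    convert dvd_sub h1 h2 using 1
    ring
  · rw [entry_cons_succ, if_neg (Nat.succ_ne_zero i), Nat.add_sub_cancel]
    convert h1.mul_left (1 - X ^ entry s i) using 1
    ring

theorem hasSum_summand (m i : ℕ) :
    HasSum (fun s : {s : Fin (m + i) → ℕ // Antitone s} => summand i s.1)
      (productSide (m + 1 + i) i) := by
  set g : (Fin (m + i) → ℕ) → ℤ⟦X⟧ := fun s =>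
    (if i = 0 then 1 else 1 - X ^ entry s (i - 1)) * tupleTerm i s with hg
  have hg0 : ∀ s, ¬ Antitone s → g s = 0 := fun s hs => by
    simp only [hg, tupleTerm]
    rw [prod_invPoch_eq_zero_of_not_antitone hs, mul_zero, mul_zero]
  have hcongr : (fun s : {s : Fin (m + i) → ℕ // Antitone s} => summand i s.1) =
      g ∘ ((↑) : {s : Fin (m + i) → ℕ | Antitone s} → Fin (m + i) → ℕ) :=
    funext fun s => summand_eq_tupleTerm (Nat.le_add_left i m) s.2
  rw [hcongr]
  refine (hasSum_subtype_iff_of_support_subset ?_).mpr ?_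
  · intro s hs
    by_contra h
    exact hs (hg0 s h)
  rw [WithPiTopology.hasSum_iff_hasSum_coeff]
  intro n
  -- Truncating at N = n + 1 already gives the exact coefficient of q^n, term by term; it also shows
  -- that tuples with s_1 > n + 1 contribute nothing.
  have hstab : ∀ s, coeff n (qPoch X X (n + 1) * (invPoch X ((n + 1 : ℕ) - entry s 0) *
      ((1 - X ^ entry (Fin.cons (n + 1) s : Fin (m + i + 1) → ℕ) i) * tupleTerm i s))) =
      coeff n (g s) := by
    intro s
    have := X_pow_dvd_iff.mp (X_pow_dvd_truncated_sub i (n + 1) s) n (Nat.lt_succ_self n)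
    rwa [map_sub, sub_eq_zero] at this
  have hsum : coeff n (productSide (m + 1 + i) i) =
      ∑ s ∈ Fintype.piFinset (fun _ : Fin (m + i) => Finset.range (n + 1 + 1)), coeff n (g s) := by
    have h := X_pow_dvd_rectSum_sub_productSide (m := m + 1) (i := i) (by omega) (n + 1)
    have h' := X_pow_dvd_iff.mp h n (Nat.lt_succ_self n)
    rw [map_sub, sub_eq_zero] at h'
    rw [← h', rectSum_eq_sum_tupleTerm m i le_rfl, Finset.mul_sum, map_sum]
    exact Finset.sum_congr rfl fun s _ => hstab s
  rw [hsum]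
  refine hasSum_sum_of_ne_finset_zero fun s hs => ?_
  by_cases hanti : Antitone s
  · rw [← hstab, invPoch_of_neg X (n := (n + 1 : ℕ) - entry s 0)]
    · simp
    · rw [Fintype.mem_piFinset] at hs
      push Not at hs
      obtain ⟨a, ha⟩ := hs
      rw [Finset.mem_range, not_lt] at ha
      have h1 := antitone_entry hanti (Nat.zero_le a)
      rw [entry_val] at h1
      omega
  · rw [hg0 s hanti, map_zero]

/-! ### Partitions with congruence conditions -/

/-- The class of c among positive integers is c + bj, j ≥ 0. Allowing c = b covers the multiples of
b. -/
theorem hasProd_residueClass {b c : ℕ} (hc : 0 < c) (hcb : c ≤ b) :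
    HasProd (fun k : ℕ => if (k + 1) % b = c % b then (1 - X ^ (k + 1) : ℤ⟦X⟧) else 1)
      (qPochInf (X ^ c) (X ^ b)) := by
  have hb : 0 < b := by omega
  have hinj : Function.Injective fun j : ℕ => c + b * j - 1 := by
    intro j j' h
    have : b * j = b * j' := by dsimp only at h; omega
    exact Nat.eq_of_mul_eq_mul_left hb this
  rw [← hinj.hasProd_iff]
  · refine Eq.mp (congrArg (fun f => HasProd f _) (funext fun j => ?_))
      (multipliable_qPochInf c hb).hasProd
    have h : c + b * j - 1 + 1 = c + b * j := by omega
    simp only [Function.comp_apply]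
    rw [h, Nat.add_mul_mod_self_left, if_pos rfl, pow_add, pow_mul]
  · intro k hk
    rw [if_neg]
    intro h
    have hle : c ≤ k + 1 := by
      by_contra! hlt
      rw [Nat.mod_eq_of_lt (by omega : k + 1 < b)] at h
      rcases hcb.eq_or_lt with rfl | hcb
      · rw [Nat.mod_self] at h; omega
      · rw [Nat.mod_eq_of_lt hcb] at h; omega
    obtain ⟨j, hj⟩ := (Nat.modEq_iff_dvd' hle).mp h.symm
    exact hk ⟨j, by dsimp only; omega⟩

theorem intCast_modEq_iff {b m c : ℕ} {d : ℤ} (hc : c < b) (hd : d ≡ c [ZMOD b]) :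
    (m : ℤ) ≡ d [ZMOD b] ↔ m % b = c := by
  have h : m % b = c ↔ m ≡ c [MOD b] := by rw [Nat.ModEq, Nat.mod_eq_of_lt hc]
  rw [h, ← Int.natCast_modEq_iff]
  exact ⟨fun h => h.trans hd, fun h => h.trans hd.symm⟩

theorem mk_card_congruencePartitions {r i : ℕ} (hi : 1 ≤ i) (hir : i ≤ r) :
    (PowerSeries.mk fun n => ((congruencePartitions r i n).card : ℤ)) = productSide r (r - i) := by
  have h0 := Nat.Partition.hasProd_powerSeriesMk_card_restricted ℤ fun m : ℕ =>
    ¬ (m : ℤ) ≡ 0 [ZMOD 2 * r + 1] ∧ ¬ (m : ℤ) ≡ i [ZMOD 2 * r + 1] ∧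
      ¬ (m : ℤ) ≡ -i [ZMOD 2 * r + 1]
  have hE : HasProd (fun k : ℕ => (1 - X ^ (k + 1) : ℤ⟦X⟧)) (qPochInf X X) := by
    have h := (multipliable_qPochInf 1 one_pos).hasProd
    simp only [pow_one] at h
    simp_rw [pow_succ']
    exact h
  have h1 := ((hasProd_residueClass (b := 2 * r + 1) (c := 2 * r + 1) (by omega) le_rfl).mul
    (hasProd_residueClass (b := 2 * r + 1) (c := i) (by omega) (by omega))).mul
    (hasProd_residueClass (b := 2 * r + 1) (c := 2 * r + 1 - i) (by omega) (by omega))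
  -- Multiplying by (q)_∞ cancels the geometric series of each allowed part. Each forbidden part
  -- keeps one factor, since 0, i and 2r + 1 - i are distinct residues for 1 ≤ i ≤ r.
  have hfun : ∀ k : ℕ, (if ¬ ((k + 1 : ℕ) : ℤ) ≡ 0 [ZMOD 2 * r + 1] ∧
      ¬ ((k + 1 : ℕ) : ℤ) ≡ i [ZMOD 2 * r + 1] ∧ ¬ ((k + 1 : ℕ) : ℤ) ≡ -i [ZMOD 2 * r + 1]
      then ∑' j : ℕ, (X : ℤ⟦X⟧) ^ ((k + 1) * j) else 1) * (1 - X ^ (k + 1)) =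
      (if (k + 1) % (2 * r + 1) = (2 * r + 1) % (2 * r + 1) then (1 - X ^ (k + 1)) else 1) *
      (if (k + 1) % (2 * r + 1) = i % (2 * r + 1) then (1 - X ^ (k + 1)) else 1) *
      (if (k + 1) % (2 * r + 1) = (2 * r + 1 - i) % (2 * r + 1) then (1 - X ^ (k + 1)) else 1) := by
    intro k
    have hgeom : (∑' j : ℕ, (X : ℤ⟦X⟧) ^ ((k + 1) * j)) * (1 - X ^ (k + 1)) = 1 := by
      simp_rw [pow_mul]
      exact WithPiTopology.tsum_pow_mul_one_sub_of_constantCoeff_eq_zero (by simp)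
    have e : (2 * r + 1 : ℤ) = ((2 * r + 1 : ℕ) : ℤ) := by push_cast; ring
    have hneg : (-i : ℤ) ≡ ((2 * r + 1 - i : ℕ) : ℤ) [ZMOD (2 * r + 1 : ℕ)] := by
      rw [Int.modEq_iff_dvd]
      exact ⟨1, by omega⟩
    have m0 : ((k + 1 : ℕ) : ℤ) ≡ 0 [ZMOD 2 * r + 1] ↔ (k + 1) % (2 * r + 1) = 0 := by
      rw [e]; exact intCast_modEq_iff (by omega) (Int.ModEq.refl _)
    have m1 : ((k + 1 : ℕ) : ℤ) ≡ i [ZMOD 2 * r + 1] ↔ (k + 1) % (2 * r + 1) = i := by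
      rw [e]; exact intCast_modEq_iff (by omega) (Int.ModEq.refl _)
    have m2 : ((k + 1 : ℕ) : ℤ) ≡ -i [ZMOD 2 * r + 1] ↔
        (k + 1) % (2 * r + 1) = 2 * r + 1 - i := by
      rw [e]; exact intCast_modEq_iff (by omega) hneg
    simp only [m0, m1, m2]
    rw [Nat.mod_self, Nat.mod_eq_of_lt (show i < 2 * r + 1 by omega),
      Nat.mod_eq_of_lt (show 2 * r + 1 - i < 2 * r + 1 by omega)]
    by_cases c0 : (k + 1) % (2 * r + 1) = 0
    · rw [if_neg (by omega), if_pos c0, if_neg (by omega), if_neg (by omega)]; ring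
    by_cases c1 : (k + 1) % (2 * r + 1) = i
    · rw [if_neg (by omega), if_neg c0, if_pos c1, if_neg (by omega)]; ring
    by_cases c2 : (k + 1) % (2 * r + 1) = 2 * r + 1 - i
    · rw [if_neg (by omega), if_neg c0, if_neg c1, if_pos c2]; ring
    · rw [if_pos ⟨c0, c1, c2⟩, if_neg c0, if_neg c1, if_neg c2, hgeom]; ring
  have h2 := h0.mul hE
  simp only [hfun] at h2
  have h3 := h2.unique h1
  rw [productSide, show r - (r - i) = i by omega, show r + (r - i) + 1 = 2 * r + 1 - i by omega,
    ← h3, mul_assoc, Ring.mul_inverse_cancel _ isUnit_qPochInf, mul_one]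
  rfl

end AndrewsGordon

theorem mainTheorem5 (r : ℕ) (hr : 0 < r) :
    (∀ i : ℕ, i ≤ r - 1 →
      HasSum (fun s : {s : Fin (r - 1) → ℕ // Antitone s} => AndrewsGordon.summand i s.1)
        (AndrewsGordon.productSide r i)) ∧
    (∀ i : ℕ, i ≤ r - 1 →
      HasSum (fun s : {s : Fin (r - 1) → ℕ // Antitone s} => AndrewsGordon.summand i s.1)
        (PowerSeries.mk fun n => ((AndrewsGordon.durfeePartitions r (r - i) n).card : ℤ))) ∧
    (∀ i : ℕ, 1 ≤ i → i ≤ r → ∀ n : ℕ,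
      (AndrewsGordon.durfeePartitions r i n).card =
        (AndrewsGordon.congruencePartitions r i n).card) := by
  have hproduct : ∀ i ≤ r - 1, AndrewsGordon.productSide r i =
      PowerSeries.mk fun n => ((AndrewsGordon.durfeePartitions r (r - i) n).card : ℤ) := by
    intro i hi
    obtain ⟨m, rfl⟩ : ∃ m, r = m + 1 + i := ⟨r - 1 - i, by omega⟩
    ext n
    rw [PowerSeries.coeff_mk, Nat.add_sub_cancel]
    exact AndrewsGordon.coeff_productSide m i n
  have hsum : ∀ i ≤ r - 1,
      HasSum (fun s : {s : Fin (r - 1) → ℕ // Antitone s} => AndrewsGordon.summand i s.1)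
        (AndrewsGordon.productSide r i) := by
    intro i hi
    obtain ⟨m, hm⟩ : ∃ m, r - 1 = m + i := ⟨r - 1 - i, by omega⟩
    obtain rfl : r = m + 1 + i := by omega
    rw [hm]
    exact AndrewsGordon.hasSum_summand m i
  refine ⟨hsum, fun i hi => hproduct i hi ▸ hsum i hi, fun i hi hir n => ?_⟩
  have h := AndrewsGordon.mk_card_congruencePartitions hi hir
  rw [hproduct (r - i) (by omega), show r - (r - i) = i by omega] at h
  have h' := congrArg (PowerSeries.coeff n) h
  rw [PowerSeries.coeff_mk, PowerSeries.coeff_mk] at h'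
  exact_mod_cast h'.symm
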